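/- All graphs are simple and undirected, with vertex set $[n]$. A randomized query algorithm may use internal randomness and accesses the unknown graph $G=([n],E)$ only through adaptive queries of three types: an independent-set query (given $U\subseteq[n]$, is $U$ independent in $G$?), a degree query (given $u\in[n]$, returns $\deg(u)$), and a random-neighbor query (given $u\in[n]$, returns a uniformly random neighbor of $u$, drawn independently at every call, or a special symbol if $u$ has no neighbor). **Theorem.** There are an absolute constant $C>0$ and a randomized query algorithm that takes as input an integer $n\ge 1$ and a parameter $\varepsilon\in(0,1]$ and has query access to a graph $G=([n],E)$ such that for all $n$, $\varepsilon$ and $G$, with $m=|E|$, the following holds. 1. The algorithm halts almost surely and outputs a real number $\tilde m$ with $$\Pr\bigl[(1-\varepsilon)m\le \tilde m\le (1+\varepsilon)m\bigr]\ge \tfrac23 .$$ 2. If $m\ge 1$, the expected number of queries is at most $$C\cdot\frac{\log n}{\varepsilon^{5/2}}\cdot\min\left(\sqrt m,\ \sqrt{\frac{n}{\sqrt m}}\right).$$ If $m=0$, the expected number of queries is at most $1$. -/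

import Mathlib

/-- The queries available on an unknown graph with vertex set `Fin n`. -/
inductive GraphQuery (n : ℕ) : Type
  /-- Is the vertex set `U` independent? -/
  | indep (U : Finset (Fin n))
  /-- What is the degree of `u`? -/
  | degree (u : Fin n)
  /-- Give a uniformly random neighbor of `u`. -/
  | neighbor (u : Fin n)

/-- The type of answers to a query. A random-neighbor query is answered by `none` on an
isolated vertex. -/
def GraphQuery.Answer {n : ℕ} : GraphQuery n → Type
  | .indep _ => Bool
  | .degree _ => ℕ
  | .neighbor _ => Option (Fin n)

open Classical in
/-- The law of the answer of the oracles of the graph `G` to a query. Independent-set and degree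
queries are answered deterministically; a random-neighbor query is answered with fresh
randomness at every call. -/
noncomputable def graphOracle {n : ℕ} (G : SimpleGraph (Fin n)) :
    (q : GraphQuery n) → PMF q.Answer
  | .indep U => (PMF.pure (decide (G.IsIndepSet (U : Set (Fin n)))) : PMF Bool)
  | .degree u => (PMF.pure (G.degree u) : PMF ℕ)
  | .neighbor u =>
      if h : (G.neighborFinset u).Nonempty then
        ((PMF.uniformOfFinset (G.neighborFinset u) h).map some : PMF (Option (Fin n)))
      else (PMF.pure none : PMF (Option (Fin n)))

/-- What an algorithm with internal states in `σ` does in one step: ask one query and continue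
according to the answer, make an internal random move, or halt and output a real number. -/
inductive GraphAction (n : ℕ) (σ : Type) : Type
  | query (q : GraphQuery n) (next : q.Answer → σ)
  | toss (p : PMF σ)
  | output (r : ℝ)

/-- A randomized adaptive query algorithm for graphs with vertex set `Fin n`. The graph is
accessible only through the answers to the queries. -/
structure GraphAlgorithm (n : ℕ) where
  /-- internal states -/
  State : Type
  /-- initial state -/
  start : State
  /-- action taken in each state -/
  act : State → GraphAction n State

namespace GraphAlgorithm

variable {n : ℕ} (A : GraphAlgorithm n) (G : SimpleGraph (Fin n))

/-- One step of the execution of `A` on `G`. A configuration consists of the internal state and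
of the number of queries made so far; after an output the configuration no longer changes. -/
noncomputable def step (c : A.State × ℕ) : PMF (A.State × ℕ) :=
  match A.act c.1 with
  | .query q next => (graphOracle G q).map fun a => (next a, c.2 + 1)
  | .toss p => p.map fun s => (s, c.2)
  | .output _ => PMF.pure c

/-- The law of the configuration of `A` on `G` after `t` steps. -/
noncomputable def run : ℕ → PMF (A.State × ℕ)
  | 0 => PMF.pure (A.start, 0)
  | t + 1 => (run t).bind (A.step G)

/-- The probability that `A`, run on `G`, halts with an output in `S`: the limit (supremum) over
`t` of the probability that this has happened within `t` steps. -/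
noncomputable def outputProb (S : Set ℝ) : ENNReal :=
  ⨆ t : ℕ, (A.run G t).toOuterMeasure {c | ∃ r ∈ S, A.act c.1 = .output r}

/-- The expected total number of queries that `A` makes on `G`: the limit (supremum) over `t` of
the expected number of queries made within `t` steps. -/
noncomputable def expectedQueries : ENNReal :=
  ⨆ t : ℕ, ∑' c : A.State × ℕ, A.run G t c * (c.2 : ENNReal)

end GraphAlgorithm

open scoped Classical

/-! The edges inside a vertex set can be counted exactly with one independent-set query plus `O(log
n)` queries per edge, by binary search (`countEdges_spec`). So one colors the vertices at random,
counts the monochromatic edges in some of the color classes, and rescales. The variance is a sum of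
covariances of pairs of edges (`colMean_sq_monoSum_le`). Distinct edges are correlated only if they
share a vertex and not all classes are searched; in that case vertices of high degree must be
excluded.

This gives two estimators for level `i`. From below, with guess `4 ^ i` for `m`, all of at most `2 ^
i` classes are searched; the variance is at most `ε² 4^i m / 20000`, and the cost is of order `2^i
log n / ε²` if `m ≤ 4 ^ i`. From above, with guess `β²` where `β` is about `n / 4^i`, about `2^i /
ε²` of `β` classes are searched for edges whose endpoints both have degree below `θ = 2^i β / 2`.
The remaining edges are estimated from random neighbors (`edgeSum_lowWeight_add`,
`mean_sq_sample_le`). The cost has the same order as long as `m` is not much larger than `β²`.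

Both estimators are run for `i = 0, 1, ...`. A lower estimate is accepted if it does not much exceed
its guess, an upper one if it is not much smaller than its guess. Let `l` be the first level at
which one of the guesses has crossed `m`; then `2^l` is at most a constant times `min(√m, √(n/√m))`
(`exists_level`). Before level `l` the probabilities of accepting a wrong value grow geometrically,
so their sum is governed by level `l` (`mean_search_le`). From level `l` on, each level is passed
with probability at most `1/64` while costs grow by a factor of at most `32`, so the expected cost
is again governed by level `l` (`cost_search_le`). The resulting dependence on `ε` is `ε⁻²`. A
single initial query on the whole vertex set settles `m = 0`. -/

/-- Query algorithms as well-founded decision trees. -/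
inductive QueryProg (n : ℕ) (α : Type) : Type
  | ret (a : α)
  | query (q : GraphQuery n) (next : q.Answer → QueryProg n α)
  | toss (k : ℕ) (next : Fin (k + 1) → QueryProg n α)

/-! ### Decision trees: expected values and expected cost -/

namespace QueryProg

variable {n : ℕ} {α β : Type}

/-- The algorithm that executes a decision tree. -/
noncomputable abbrev toAlgorithm (p : QueryProg n ℝ) : GraphAlgorithm n where
  State := QueryProg n ℝ
  start := p
  act
    | ret a => .output a
    | query q next => .query q next
    | toss k next => .toss ((PMF.uniformOfFintype (Fin (k + 1))).map next)

/-- Sequential composition. -/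
def bind : QueryProg n α → (α → QueryProg n β) → QueryProg n β
  | ret a, f => f a
  | query q next, f => query q fun a => (next a).bind f
  | toss k next, f => toss k fun i => (next i).bind f

/-- The expected value of a function of the answer to a query. -/
noncomputable def answerMean (G : SimpleGraph (Fin n)) :
    (q : GraphQuery n) → (q.Answer → ℝ) → ℝ
  | .indep U, f => f (decide (G.IsIndepSet (U : Set (Fin n))))
  | .degree u, f => f (G.degree u)
  | .neighbor u, f =>
      if G.degree u = 0 then f (none : Option (Fin n))
      else (∑ v ∈ G.neighborFinset u, f (some v : Option (Fin n))) / G.degree u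

/-- The expected value of a function of the output of a program. -/
noncomputable def mean (G : SimpleGraph (Fin n)) : QueryProg n α → (α → ℝ) → ℝ
  | ret a, f => f a
  | query q next, f => answerMean G q fun a => (next a).mean G f
  | toss k next, f => (∑ i, (next i).mean G f) / ((k + 1 : ℕ) : ℝ)

/-- The expected number of queries of a program. -/
noncomputable def cost (G : SimpleGraph (Fin n)) : QueryProg n α → ℝ
  | ret _ => 0
  | query q next => 1 + answerMean G q fun a => (next a).cost G
  | toss k next => (∑ i, (next i).cost G) / ((k + 1 : ℕ) : ℝ)

section Mean

variable (G : SimpleGraph (Fin n))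

theorem answerMean_add (q : GraphQuery n) (f g : q.Answer → ℝ) :
    answerMean G q (fun a => f a + g a) = answerMean G q f + answerMean G q g := by
  cases q with
  | indep U => rfl
  | degree u => rfl
  | neighbor u =>
    simp only [answerMean]
    split_ifs
    · rfl
    · rw [Finset.sum_add_distrib, add_div]

theorem answerMean_mul_left (q : GraphQuery n) (c : ℝ) (f : q.Answer → ℝ) :
    answerMean G q (fun a => c * f a) = c * answerMean G q f := by
  cases q with
  | indep U => rfl
  | degree u => rfl
  | neighbor u =>
    simp only [answerMean]
    split_ifs
    · rfl
    · rw [← Finset.mul_sum, mul_div_assoc]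

theorem answerMean_mono (q : GraphQuery n) {f g : q.Answer → ℝ} (h : ∀ a, f a ≤ g a) :
    answerMean G q f ≤ answerMean G q g := by
  cases q with
  | indep U => exact h _
  | degree u => exact h _
  | neighbor u =>
    simp only [answerMean]
    split_ifs
    · exact h _
    · exact div_le_div_of_nonneg_right (Finset.sum_le_sum fun v _ => h _) (Nat.cast_nonneg _)

theorem answerMean_const (q : GraphQuery n) (c : ℝ) : answerMean G q (fun _ => c) = c := by
  cases q with
  | indep U => rfl
  | degree u => rfl
  | neighbor u =>
    simp only [answerMean]
    split_ifs with h
    · rfl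
    · rw [Finset.sum_const, SimpleGraph.card_neighborFinset_eq_degree, nsmul_eq_mul]
      have : (G.degree u : ℝ) ≠ 0 := by exact_mod_cast h
      field_simp

theorem mean_add (p : QueryProg n α) (f g : α → ℝ) :
    p.mean G (fun a => f a + g a) = p.mean G f + p.mean G g := by
  induction p with
  | ret a => rfl
  | query q next ih => simp only [mean, ih, answerMean_add]
  | toss k next ih => simp only [mean, ih, Finset.sum_add_distrib, add_div]

theorem mean_mul_left (p : QueryProg n α) (c : ℝ) (f : α → ℝ) :
    p.mean G (fun a => c * f a) = c * p.mean G f := by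
  induction p with
  | ret a => rfl
  | query q next ih => simp only [mean, ih, answerMean_mul_left]
  | toss k next ih => simp only [mean, ih, ← Finset.mul_sum, mul_div_assoc]

theorem mean_mono (p : QueryProg n α) {f g : α → ℝ} (h : ∀ a, f a ≤ g a) :
    p.mean G f ≤ p.mean G g := by
  induction p with
  | ret a => exact h a
  | query q next ih => exact answerMean_mono G q ih
  | toss k next ih =>
    exact div_le_div_of_nonneg_right (Finset.sum_le_sum fun i _ => ih i) (Nat.cast_nonneg _)

theorem mean_const (p : QueryProg n α) (c : ℝ) : p.mean G (fun _ => c) = c := by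
  induction p with
  | ret a => rfl
  | query q next ih => simp only [mean, ih, answerMean_const]
  | toss k next ih =>
    simp only [mean, ih, Finset.sum_const, Finset.card_univ, Fintype.card_fin, nsmul_eq_mul]
    have : ((k + 1 : ℕ) : ℝ) ≠ 0 := by positivity
    field_simp

theorem mean_nonneg (p : QueryProg n α) {f : α → ℝ} (h : ∀ a, 0 ≤ f a) : 0 ≤ p.mean G f := by
  simpa [mean_const] using mean_mono G p h

theorem mean_sub (p : QueryProg n α) (f g : α → ℝ) :
    p.mean G (fun a => f a - g a) = p.mean G f - p.mean G g := by
  have := mean_add G p f (fun a => (-1) * g a)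
  rw [mean_mul_left] at this
  simp only [sub_eq_add_neg, neg_mul, one_mul] at this ⊢
  exact this

theorem mean_bind (p : QueryProg n α) (k : α → QueryProg n β) (f : β → ℝ) :
    (p.bind k).mean G f = p.mean G fun a => (k a).mean G f := by
  induction p with
  | ret a => rfl
  | query q next ih => simp only [bind, mean, ih]
  | toss k next ih => simp only [bind, mean, ih]

theorem cost_bind (p : QueryProg n α) (k : α → QueryProg n β) :
    (p.bind k).cost G = p.cost G + p.mean G fun a => (k a).cost G := by
  induction p with
  | ret a => simp [bind, mean, cost]
  | query q next ih => simp only [bind, mean, cost, ih, answerMean_add, add_assoc]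
  | toss k next ih => simp only [bind, mean, cost, ih, Finset.sum_add_distrib, add_div]

theorem cost_nonneg (p : QueryProg n α) : 0 ≤ p.cost G := by
  induction p with
  | ret a => exact le_rfl
  | query q next ih =>
    have := answerMean_mono G q ih
    rw [answerMean_const] at this
    simp only [cost]
    linarith
  | toss k next ih => exact div_nonneg (Finset.sum_nonneg fun i _ => ih i) (Nat.cast_nonneg _)

end Mean

/-! ### From decision trees to the execution model -/

section Run

variable (G : SimpleGraph (Fin n))

theorem tsum_pure_mul {γ : Type*} (x : γ) (g : γ → ENNReal) :
    ∑' a, PMF.pure x a * g a = g x := by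
  rw [tsum_eq_single x]
  · simp
  · intro b hb
    simp [PMF.pure_apply, hb]

theorem tsum_neighborLaw_mul (u : Fin n) (f : Option (Fin n) → ℝ) (hf : ∀ a, 0 ≤ f a) :
    ∑' a, (if h : (G.neighborFinset u).Nonempty then
        (PMF.uniformOfFinset (G.neighborFinset u) h).map some
      else PMF.pure none : PMF (Option (Fin n))) a * ENNReal.ofReal (f a) =
      ENNReal.ofReal (if G.degree u = 0 then f none
        else (∑ v ∈ G.neighborFinset u, f (some v)) / G.degree u) := by
  by_cases h : (G.neighborFinset u).Nonempty
  · have hd : G.degree u ≠ 0 := by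
      rw [← SimpleGraph.card_neighborFinset_eq_degree]
      exact Finset.card_ne_zero.mpr h
    have hd' : (0 : ℝ) < G.degree u := by exact_mod_cast Nat.pos_of_ne_zero hd
    have h0 : (PMF.map some (PMF.uniformOfFinset (G.neighborFinset u) h)) none = 0 := by
      rw [PMF.map_apply]
      simp
    have h1 : ∀ v : Fin n, (PMF.map some (PMF.uniformOfFinset (G.neighborFinset u) h)) (some v)
        = PMF.uniformOfFinset (G.neighborFinset u) h v := by
      intro v
      rw [PMF.map_apply, tsum_eq_single v]
      · simp
      · intro w hw
        simp [Ne.symm hw]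
    rw [dif_pos h, if_neg hd, tsum_fintype, Fintype.sum_option, h0, zero_mul, zero_add,
      ENNReal.ofReal_div_of_pos hd', ENNReal.ofReal_sum_of_nonneg (fun v _ => hf _),
      ENNReal.div_eq_inv_mul, Finset.mul_sum,
      ← Finset.sum_subset (Finset.subset_univ (G.neighborFinset u))]
    · refine Finset.sum_congr rfl fun v hv => ?_
      rw [h1, PMF.uniformOfFinset_apply_of_mem h hv, SimpleGraph.card_neighborFinset_eq_degree,
        ENNReal.ofReal_natCast]
    · intro v _ hv
      rw [h1, PMF.uniformOfFinset_apply_of_notMem h hv, zero_mul]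
  · have hd : G.degree u = 0 := by
      rw [← SimpleGraph.card_neighborFinset_eq_degree]
      exact Finset.card_eq_zero.mpr (Finset.not_nonempty_iff_eq_empty.mp h)
    rw [dif_neg h, if_pos hd]
    exact tsum_pure_mul _ _

theorem tsum_graphOracle_mul (q : GraphQuery n) (f : q.Answer → ℝ) (hf : ∀ a, 0 ≤ f a) :
    ∑' a, graphOracle G q a * ENNReal.ofReal (f a) = ENNReal.ofReal (answerMean G q f) := by
  cases q with
  | indep U => exact tsum_pure_mul (γ := Bool) _ _
  | degree u => exact tsum_pure_mul (γ := ℕ) _ _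
  | neighbor u => exact tsum_neighborLaw_mul G u f hf

/-- The law of the configuration after `t` steps from a given configuration. -/
noncomputable def runFrom (A : GraphAlgorithm n) : ℕ → A.State × ℕ → PMF (A.State × ℕ)
  | 0, c => PMF.pure c
  | t + 1, c => (A.step G c).bind (runFrom A t)

theorem run_bind_runFrom (A : GraphAlgorithm n) (s t : ℕ) :
    (A.run G t).bind (runFrom G A s) = A.run G (t + s) := by
  induction s generalizing t with
  | zero => exact PMF.bind_pure _
  | succ s ih =>
    have : (A.run G t).bind (runFrom G A (s + 1)) = (A.run G (t + 1)).bind (runFrom G A s) := by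
      rw [GraphAlgorithm.run, PMF.bind_bind]
      rfl
    rw [this, ih]
    congr 1
    omega

theorem run_eq_runFrom (A : GraphAlgorithm n) (t : ℕ) : A.run G t = runFrom G A t (A.start, 0) := by
  have := run_bind_runFrom G A t 0
  rw [GraphAlgorithm.run, PMF.pure_bind, zero_add] at this
  exact this.symm

theorem runFrom_ret (p : QueryProg n ℝ) (a : ℝ) (t c : ℕ) :
    runFrom G p.toAlgorithm t (ret a, c) = PMF.pure (ret a, c) := by
  induction t with
  | zero => rfl
  | succ t ih =>
    have : GraphAlgorithm.step p.toAlgorithm G (ret a, c) = PMF.pure (ret a, c) := rfl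
    rw [runFrom, this, PMF.pure_bind]
    exact ih

theorem runFrom_query (p : QueryProg n ℝ) (q : GraphQuery n) (next : q.Answer → QueryProg n ℝ)
    (t c : ℕ) :
    runFrom G p.toAlgorithm (t + 1) (query q next, c) =
      (graphOracle G q).bind fun a => runFrom G p.toAlgorithm t (next a, c + 1) := by
  have : GraphAlgorithm.step p.toAlgorithm G (query q next, c) =
      (graphOracle G q).map fun a => (next a, c + 1) := rfl
  rw [runFrom, this, PMF.bind_map]
  rfl

theorem runFrom_toss (p : QueryProg n ℝ) (k : ℕ) (next : Fin (k + 1) → QueryProg n ℝ)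
    (t c : ℕ) :
    runFrom G p.toAlgorithm (t + 1) (toss k next, c) =
      (PMF.uniformOfFintype (Fin (k + 1))).bind
        fun i => runFrom G p.toAlgorithm t (next i, c) := by
  have : GraphAlgorithm.step p.toAlgorithm G (toss k next, c) =
      ((PMF.uniformOfFintype (Fin (k + 1))).map next).map fun s => (s, c) := rfl
  rw [runFrom, this, PMF.map_comp, PMF.bind_map]
  rfl

theorem tsum_uniform_mul (k : ℕ) (f : Fin (k + 1) → ℝ) (hf : ∀ i, 0 ≤ f i) :
    ∑' i, PMF.uniformOfFintype (Fin (k + 1)) i * ENNReal.ofReal (f i) =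
      ENNReal.ofReal ((∑ i, f i) / ((k + 1 : ℕ) : ℝ)) := by
  rw [tsum_fintype, ENNReal.ofReal_div_of_pos (by positivity),
    ENNReal.ofReal_sum_of_nonneg (fun v _ => hf _), ENNReal.div_eq_inv_mul, Finset.mul_sum]
  refine Finset.sum_congr rfl fun i _ => ?_
  rw [PMF.uniformOfFintype_apply, Fintype.card_fin, ENNReal.ofReal_natCast]

theorem tsum_bind_mul {γ δ : Type*} (P : PMF γ) (f : γ → PMF δ) (g : δ → ENNReal) :
    ∑' c, (P.bind f) c * g c = ∑' a, P a * ∑' c, f a c * g c := by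
  simp only [PMF.bind_apply, ← ENNReal.tsum_mul_right, ← ENNReal.tsum_mul_left]
  rw [ENNReal.tsum_comm]
  simp only [mul_assoc]

/-- Counter plus expected remaining cost is conserved in expectation by every step, and it always
dominates the counter. -/
theorem tsum_runFrom_le (p₀ p : QueryProg n ℝ) (t c : ℕ) :
    ∑' x : QueryProg n ℝ × ℕ, runFrom G p₀.toAlgorithm t (p, c) x * (x.2 : ENNReal) ≤
      ENNReal.ofReal (c + p.cost G) := by
  have hpure : ∀ (p : QueryProg n ℝ) (c : ℕ),
      ∑' x : QueryProg n ℝ × ℕ, PMF.pure (p, c) x * (x.2 : ENNReal) ≤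
        ENNReal.ofReal (c + p.cost G) := by
    intro p c
    rw [tsum_eq_single (p, c)]
    · rw [PMF.pure_apply, if_pos rfl, one_mul, ← ENNReal.ofReal_natCast]
      exact ENNReal.ofReal_le_ofReal (by linarith [cost_nonneg G p])
    · intro b hb
      simp [PMF.pure_apply, hb]
  induction t generalizing p c with
  | zero => exact hpure p c
  | succ t ih =>
    cases p with
    | ret a =>
      rw [runFrom_ret]
      exact hpure _ _
    | query q next =>
      rw [runFrom_query, tsum_bind_mul]
      refine (ENNReal.tsum_le_tsum fun a => mul_le_mul_right (ih (next a) (c + 1)) _).trans ?_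
      rw [tsum_graphOracle_mul G q _
        (fun a => add_nonneg (Nat.cast_nonneg _) (cost_nonneg G (next a))),
        answerMean_add, answerMean_const]
      simp only [cost]
      push_cast
      rw [add_assoc]
    | toss k next =>
      rw [runFrom_toss, tsum_bind_mul]
      refine (ENNReal.tsum_le_tsum fun a => mul_le_mul_right (ih (next a) c) _).trans ?_
      rw [tsum_uniform_mul k _
        (fun a => add_nonneg (Nat.cast_nonneg _) (cost_nonneg G (next a)))]
      simp only [cost]
      rw [Finset.sum_add_distrib, add_div, Finset.sum_const, Finset.card_univ, Fintype.card_fin,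
        nsmul_eq_mul, mul_div_cancel_left₀ _ (by positivity)]

theorem expectedQueries_le (p : QueryProg n ℝ) :
    p.toAlgorithm.expectedQueries G ≤ ENNReal.ofReal (p.cost G) := by
  refine iSup_le fun t => ?_
  rw [run_eq_runFrom]
  have := tsum_runFrom_le G p p t 0
  rw [Nat.cast_zero, zero_add] at this
  exact this

/-- On a fixed graph every node has only finitely many branches of positive probability, so the
reachable part of the tree has bounded depth. After that many steps the law of the output is final.
-/
theorem exists_forall_le_runFrom (S : Set ℝ) (p₀ p : QueryProg n ℝ) :
    ∃ t₀, ∀ t, t₀ ≤ t → ∀ c,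
      ENNReal.ofReal (p.mean G (S.indicator 1)) ≤
        (runFrom G p₀.toAlgorithm t (p, c)).toOuterMeasure
          {x : QueryProg n ℝ × ℕ | ∃ r ∈ S, p₀.toAlgorithm.act x.1 = .output r} := by
  have hnn : ∀ a, 0 ≤ S.indicator (1 : ℝ → ℝ) a := fun a =>
    Set.indicator_nonneg (fun _ _ => zero_le_one) a
  induction p with
  | ret a =>
    refine ⟨0, fun t _ c => ?_⟩
    rw [runFrom_ret, PMF.toOuterMeasure_pure_apply]
    simp only [mean]
    by_cases ha : a ∈ S
    · have : ((ret a, c) : QueryProg n ℝ × ℕ) ∈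
          {x : QueryProg n ℝ × ℕ | ∃ r ∈ S, p₀.toAlgorithm.act x.1 = .output r} := ⟨a, ha, rfl⟩
      erw [if_pos this]
      simp [ha]
    · simp [ha]
  | query q next ih =>
    choose T hT using ih
    -- A degree query has infinitely many formal answers, so the times `T a` may be unbounded; only
    -- answers that can occur matter.
    have key : ∃ t₀, ∀ a, T a ≤ t₀ ∨ graphOracle G q a = 0 := by
      cases q with
      | indep U =>
        refine ⟨T (decide (G.IsIndepSet (U : Set (Fin n))) : Bool), fun a => ?_⟩
        by_cases h : a = (decide (G.IsIndepSet (U : Set (Fin n))) : Bool)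
        · exact Or.inl (h ▸ le_rfl)
        · exact Or.inr (if_neg h)
      | degree u =>
        refine ⟨T (G.degree u : ℕ), fun a => ?_⟩
        by_cases h : a = (G.degree u : ℕ)
        · exact Or.inl (h ▸ le_rfl)
        · exact Or.inr (if_neg h)
      | neighbor u =>
        exact ⟨(Finset.univ : Finset (Option (Fin n))).sup T,
          fun a => Or.inl (Finset.le_sup (f := T) (Finset.mem_univ (α := Option (Fin n)) a))⟩
    obtain ⟨t₀, ht₀⟩ := key
    refine ⟨t₀ + 1, fun t ht c => ?_⟩
    obtain ⟨t, rfl⟩ : ∃ s, t = s + 1 := ⟨t - 1, by omega⟩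
    rw [runFrom_query, PMF.toOuterMeasure_bind_apply]
    simp only [mean]
    rw [← tsum_graphOracle_mul G q _ (fun a => mean_nonneg G _ hnn)]
    refine ENNReal.tsum_le_tsum fun a => ?_
    rcases ht₀ a with h | h
    · exact mul_le_mul_right (hT a t (by omega) _) _
    · rw [h, zero_mul]
      exact zero_le
  | toss k next ih =>
    choose T hT using ih
    refine ⟨Finset.univ.sup T + 1, fun t ht c => ?_⟩
    obtain ⟨t, rfl⟩ : ∃ s, t = s + 1 := ⟨t - 1, by omega⟩
    rw [runFrom_toss, PMF.toOuterMeasure_bind_apply]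
    simp only [mean]
    rw [← tsum_uniform_mul k _ (fun a => mean_nonneg G _ hnn)]
    refine ENNReal.tsum_le_tsum fun i => mul_le_mul_right (hT i t ?_ _) _
    have := Finset.le_sup (f := T) (Finset.mem_univ i)
    omega

theorem ofReal_mean_le_outputProb (p : QueryProg n ℝ) (S : Set ℝ) :
    ENNReal.ofReal (p.mean G (S.indicator 1)) ≤ p.toAlgorithm.outputProb G S := by
  obtain ⟨t, ht⟩ := exists_forall_le_runFrom G S p p
  refine (ht t le_rfl 0).trans ?_
  refine le_iSup_of_le t ?_
  rw [run_eq_runFrom]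

theorem outputProb_univ (p : QueryProg n ℝ) : p.toAlgorithm.outputProb G Set.univ = 1 := by
  refine le_antisymm (iSup_le fun t => ?_) ?_
  · rw [PMF.toOuterMeasure_apply, ← (p.toAlgorithm.run G t).tsum_coe]
    exact ENNReal.tsum_le_tsum fun x => Set.indicator_le_self _ _ _
  · refine le_trans ?_ (ofReal_mean_le_outputProb G p Set.univ)
    rw [Set.indicator_univ]
    have := mean_const G p 1
    rw [show (1 : ℝ → ℝ) = fun _ => 1 from rfl, this, ENNReal.ofReal_one]

end Run

end QueryProg

/-! ### Deterministic outcomes, truncation, Chebyshev, independent repetition -/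

namespace QueryProg

variable {n : ℕ} {α β : Type} (G : SimpleGraph (Fin n))

/-- The program `p` returns `a` with certainty on the graph `G`. -/
def Returns (p : QueryProg n α) (a : α) : Prop := ∀ f : α → ℝ, p.mean G f = f a

variable {G}

theorem Returns.ret (a : α) : Returns G (ret a : QueryProg n α) a := fun _ => rfl

theorem Returns.bind {p : QueryProg n α} {k : α → QueryProg n β} {a : α} {b : β}
    (hp : Returns G p a) (hk : Returns G (k a) b) : Returns G (p.bind k) b := by
  intro f
  rw [mean_bind, hp, hk]

theorem Returns.cost_bind {p : QueryProg n α} {a : α} (hp : Returns G p a)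
    (k : α → QueryProg n β) : (p.bind k).cost G = p.cost G + (k a).cost G := by
  rw [QueryProg.cost_bind, hp]

variable (G)

/-- Abort and return `none` as soon as more than `T` queries are asked. -/
def trunc : ℕ → QueryProg n α → QueryProg n (Option α)
  | _, ret a => ret (some a)
  | 0, query _ _ => ret none
  | T + 1, query q next => query q fun a => (next a).trunc T
  | T, toss k next => toss k fun i => (next i).trunc T

theorem cost_trunc_le (T : ℕ) (p : QueryProg n α) : (p.trunc T).cost G ≤ T := by
  induction p generalizing T with
  | ret a =>
    simp only [trunc, cost]
    positivity
  | query q next ih =>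
    cases T with
    | zero => simp [trunc, cost]
    | succ T =>
      have := answerMean_mono G q (fun a => ih a T)
      rw [answerMean_const] at this
      simp only [trunc, cost]
      push_cast
      linarith
  | toss k next ih =>
    simp only [trunc, cost]
    rw [div_le_iff₀ (by positivity)]
    refine (Finset.sum_le_sum fun i _ => ih i T).trans ?_
    simp [mul_comm]

/-- Truncation can only remove mass from the outputs. -/
theorem mean_trunc_le (T : ℕ) (p : QueryProg n α) {f : α → ℝ} (hf : ∀ a, 0 ≤ f a) :
    (p.trunc T).mean G (fun x => x.elim 0 f) ≤ p.mean G f := by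
  induction p generalizing T with
  | ret a => exact le_rfl
  | query q next ih =>
    cases T with
    | zero => exact mean_nonneg G _ hf
    | succ T => exact answerMean_mono G q fun a => ih a T
  | toss k next ih =>
    simp only [trunc, mean]
    exact div_le_div_of_nonneg_right (Finset.sum_le_sum fun i _ => ih i T) (Nat.cast_nonneg _)

/-- Markov's inequality for the event that the budget of queries is exceeded. -/
theorem mul_mean_trunc_none_le (T : ℕ) (p : QueryProg n α) :
    (T + 1) * (p.trunc T).mean G (fun x => x.elim 1 fun _ => 0) ≤ p.cost G := by
  have hle : ∀ (T : ℕ) (p : QueryProg n α),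
      (p.trunc T).mean G (fun x => x.elim 1 fun _ => (0 : ℝ)) ≤ 1 := by
    intro T p
    have := mean_mono G (p.trunc T) (f := fun x => x.elim 1 fun _ => (0 : ℝ)) (g := fun _ => 1)
      (by rintro (_ | a) <;> simp)
    rwa [mean_const] at this
  induction p generalizing T with
  | ret a => simp [trunc, mean, cost]
  | query q next ih =>
    cases T with
    | zero =>
      have h := answerMean_mono G q (fun a => cost_nonneg G (next a))
      rw [answerMean_const] at h
      simp only [trunc, mean, cost]
      simpa using h
    | succ T =>
      simp only [trunc, mean, cost]
      -- The factor grows by one with the budget; the extra copy of the abort probability is at most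
      -- `1` and is paid for by the query just made.
      have h1 := answerMean_mono G q fun a => ih a T
      have h2 := answerMean_mono G q fun a => hle T (next a)
      rw [answerMean_mul_left] at h1
      rw [answerMean_const] at h2
      push_cast
      linarith
  | toss k next ih =>
    simp only [trunc, mean, cost]
    rw [← mul_div_assoc, Finset.mul_sum]
    exact div_le_div_of_nonneg_right (Finset.sum_le_sum fun i _ => ih i T) (Nat.cast_nonneg _)

/-- Chebyshev's inequality. -/
theorem mul_mean_indicator_le (p : QueryProg n ℝ) {μ v t : ℝ} {S : Set ℝ} (ht : 0 ≤ t)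
    (hv : p.mean G (fun x => (x - μ) ^ 2) ≤ v) (hS : ∀ x ∈ S, t ≤ |x - μ|) :
    t ^ 2 * p.mean G (S.indicator 1) ≤ v := by
  rw [← mean_mul_left]
  refine (mean_mono G p fun x => ?_).trans hv
  by_cases hx : x ∈ S
  · rw [Set.indicator_of_mem hx, Pi.one_apply, mul_one, ← sq_abs (x - μ)]
    exact pow_le_pow_left₀ ht (hS x hx) 2
  · rw [Set.indicator_of_notMem hx, mul_zero]
    positivity

/-- A uniformly random element of a finite type. -/
noncomputable def uniform (α : Type) [Fintype α] [Nonempty α] : QueryProg n α :=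
  toss (Fintype.card α - 1) fun i => ret ((Fintype.equivFin α).symm
    (Fin.cast (Nat.sub_add_cancel Fintype.card_pos) i))

theorem mean_uniform [Fintype α] [Nonempty α] (f : α → ℝ) :
    (uniform α : QueryProg n α).mean G f = (∑ a, f a) / Fintype.card α := by
  have h : Fintype.card α - 1 + 1 = Fintype.card α := Nat.sub_add_cancel Fintype.card_pos
  simp only [uniform, mean]
  exact congrArg₂ (· / ·)
    (Fintype.sum_equiv ((finCongr h).trans (Fintype.equivFin α).symm) _ _ fun i => rfl)
    (congrArg _ h)

theorem cost_uniform [Fintype α] [Nonempty α] : (uniform α : QueryProg n α).cost G = 0 := by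
  simp [uniform, cost]

/-- Execute `p i` for all `i` in a list and add up the results. -/
def sumOver {ι : Type} (p : ι → QueryProg n ℝ) : List ι → QueryProg n ℝ
  | [] => ret 0
  | i :: l => (p i).bind fun x => (sumOver p l).bind fun y => ret (x + y)

variable {G} in
theorem returns_sumOver {ι : Type} {p : ι → QueryProg n ℝ} {a : ι → ℝ} {l : List ι}
    (h : ∀ i ∈ l, Returns G (p i) (a i)) : Returns G (sumOver p l) (l.map a).sum := by
  induction l with
  | nil => exact Returns.ret _
  | cons i l ih =>
    rw [List.map_cons, List.sum_cons]
    exact (h i (by simp)).bind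
      ((ih fun j hj => h j (List.mem_cons_of_mem _ hj)).bind (Returns.ret _))

theorem cost_sumOver {ι : Type} (p : ι → QueryProg n ℝ) (l : List ι) :
    (sumOver p l).cost G = (l.map fun i => (p i).cost G).sum := by
  induction l with
  | nil => rfl
  | cons i l ih =>
    simp only [sumOver, cost_bind, cost, mean_const, add_zero, ih, List.map_cons, List.sum_cons]

/-- The sum of `s` independent runs of `p`. -/
def repeatSum (s : ℕ) (p : QueryProg n ℝ) : QueryProg n ℝ := sumOver (fun _ => p) (List.range s)

theorem cost_repeatSum (s : ℕ) (p : QueryProg n ℝ) :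
    (repeatSum s p).cost G = s * p.cost G := by
  rw [repeatSum, cost_sumOver]
  simp

theorem mean_sub_sumOver {ι : Type} (p : QueryProg n ℝ) {μ : ℝ}
    (hμ : p.mean G (fun x => x) = μ) (l : List ι) :
    (sumOver (fun _ => p) l).mean G (fun x => x - l.length * μ) = 0 := by
  induction l with
  | nil => simp [sumOver, mean]
  | cons i l ih =>
    have e : ∀ x y : ℝ, x + y - ((l.length + 1 : ℕ) : ℝ) * μ = (x - μ) + (y - l.length * μ) := by
      intro x y
      push_cast
      ring
    simp only [sumOver, mean_bind, mean, List.length_cons, e]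
    simp only [mean_add, mean_const, ih, add_zero]
    rw [mean_sub, mean_const, hμ, sub_self]

/-- Variances of independent runs add: the cross term vanishes because each run is centered at its
mean. -/
theorem mean_sq_sumOver {ι : Type} (p : QueryProg n ℝ) {μ : ℝ}
    (hμ : p.mean G (fun x => x) = μ) (l : List ι) :
    (sumOver (fun _ => p) l).mean G (fun x => (x - l.length * μ) ^ 2) =
      l.length * p.mean G fun x => (x - μ) ^ 2 := by
  induction l with
  | nil => simp [sumOver, mean]
  | cons i l ih =>
    have e : ∀ x y : ℝ, (x + y - ((l.length + 1 : ℕ) : ℝ) * μ) ^ 2 =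
        (x - μ) ^ 2 + (2 * (x - μ) * (y - l.length * μ) + (y - l.length * μ) ^ 2) := by
      intro x y
      push_cast
      ring
    simp only [sumOver, mean_bind, mean, List.length_cons, e]
    simp only [mean_add, mean_const, mean_mul_left, ih, mean_sub_sumOver G p hμ, mul_zero, zero_add]
    push_cast
    ring

theorem mean_repeatSum (s : ℕ) (p : QueryProg n ℝ) {μ : ℝ} (hμ : p.mean G (fun x => x) = μ) :
    (repeatSum s p).mean G (fun x => x) = s * μ := by
  have := mean_sub_sumOver G p hμ (List.range s)
  rw [mean_sub, mean_const, List.length_range] at this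
  exact sub_eq_zero.mp this

theorem mean_sq_repeatSum (s : ℕ) (p : QueryProg n ℝ) {μ : ℝ}
    (hμ : p.mean G (fun x => x) = μ) :
    (repeatSum s p).mean G (fun x => (x - s * μ) ^ 2) = s * p.mean G fun x => (x - μ) ^ 2 := by
  have := mean_sq_sumOver G p hμ (List.range s)
  rwa [List.length_range] at this

theorem mean_sq_sub (p : QueryProg n ℝ) {μ : ℝ} (hμ : p.mean G (fun x => x) = μ) :
    p.mean G (fun x => (x - μ) ^ 2) = p.mean G (fun x => x ^ 2) - μ ^ 2 := by
  have e : ∀ x : ℝ, (x - μ) ^ 2 = x ^ 2 + ((-2 * μ) * x + μ ^ 2) := fun x => by ring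
  simp only [e, mean_add, mean_const]
  rw [mean_mul_left G p _ fun x => x, hμ]
  ring

end QueryProg

/-! ### Exact edge counting with independent-set queries -/

namespace QueryProg

variable {n : ℕ} {α β : Type}

/-- Branch on whether a vertex set is independent. -/
def ifIndep (U : Finset (Fin n)) (p q : QueryProg n α) : QueryProg n α :=
  query (.indep U) fun b : Bool => if b = true then p else q

/-- Ask for the degree of a vertex. -/
def withDegree (u : Fin n) (k : ℕ → QueryProg n α) : QueryProg n α :=
  query (.degree u) fun d : ℕ => k d

/-- Ask for a random neighbor of a vertex. -/
def withNeighbor (u : Fin n) (k : Option (Fin n) → QueryProg n α) : QueryProg n α :=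
  query (.neighbor u) fun v : Option (Fin n) => k v

section

variable (G : SimpleGraph (Fin n))

theorem mean_ifIndep (U : Finset (Fin n)) (p q : QueryProg n α) (f : α → ℝ) :
    (ifIndep U p q).mean G f =
      if G.IsIndepSet (U : Set (Fin n)) then p.mean G f else q.mean G f := by
  simp only [ifIndep, mean, answerMean, decide_eq_true_eq]
  split_ifs <;> rfl

theorem cost_ifIndep (U : Finset (Fin n)) (p q : QueryProg n α) :
    (ifIndep U p q).cost G =
      1 + if G.IsIndepSet (U : Set (Fin n)) then p.cost G else q.cost G := by
  simp only [ifIndep, cost, answerMean, decide_eq_true_eq]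
  split_ifs <;> rfl

theorem mean_withDegree (u : Fin n) (k : ℕ → QueryProg n α) (f : α → ℝ) :
    (withDegree u k).mean G f = (k (G.degree u)).mean G f := rfl

theorem cost_withDegree (u : Fin n) (k : ℕ → QueryProg n α) :
    (withDegree u k).cost G = 1 + (k (G.degree u)).cost G := rfl

theorem mean_withNeighbor {u : Fin n} (hu : G.degree u ≠ 0) (k : Option (Fin n) → QueryProg n α)
    (f : α → ℝ) :
    (withNeighbor u k).mean G f =
      (∑ v ∈ G.neighborFinset u, (k (some v)).mean G f) / G.degree u := by
  simp only [withNeighbor, mean, answerMean]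
  rw [if_neg hu]

theorem cost_withNeighbor_le (u : Fin n) (k : Option (Fin n) → QueryProg n α) {c : ℝ}
    (hk : ∀ v, (k v).cost G ≤ c) : (withNeighbor u k).cost G ≤ 1 + c := by
  have := answerMean_mono G (.neighbor u) (f := fun v : Option (Fin n) => (k v).cost G) hk
  rw [answerMean_const] at this
  simp only [withNeighbor, cost]
  exact add_le_add_right this 1

/-- The indicator of adjacency. -/
noncomputable def adjWeight (u v : Fin n) : ℝ := if G.Adj u v then 1 else 0

/-- The indicator of adjacency of two vertices of degree less than `θ`. -/
noncomputable def lowWeight (θ : ℝ) (u v : Fin n) : ℝ :=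
  if G.Adj u v ∧ (G.degree u : ℝ) < θ ∧ (G.degree v : ℝ) < θ then 1 else 0

/-- The sum of a symmetric weight over the unordered pairs of elements of `S`. -/
noncomputable def edgeSum (w : Fin n → Fin n → ℝ) (S : Finset (Fin n)) : ℝ :=
  (∑ u ∈ S, ∑ v ∈ S, w u v) / 2

theorem adjWeight_nonneg (u v : Fin n) : 0 ≤ adjWeight G u v := by
  unfold adjWeight; split_ifs <;> norm_num

theorem adjWeight_comm (u v : Fin n) : adjWeight G u v = adjWeight G v u := by
  simp only [adjWeight, G.adj_comm]

theorem lowWeight_comm (θ : ℝ) (u v : Fin n) : lowWeight G θ u v = lowWeight G θ v u := by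
  simp only [lowWeight, G.adj_comm u v, and_comm (a := (G.degree u : ℝ) < θ)]

theorem lowWeight_nonneg (θ : ℝ) (u v : Fin n) : 0 ≤ lowWeight G θ u v := by
  unfold lowWeight; split_ifs <;> norm_num

theorem lowWeight_le (θ : ℝ) (u v : Fin n) : lowWeight G θ u v ≤ adjWeight G u v := by
  unfold lowWeight adjWeight
  split_ifs with h1 h2 <;> first | exact absurd h1.1 h2 | norm_num

theorem lowWeight_eq_zero {θ : ℝ} {u v : Fin n} (h : ¬ G.Adj u v) : lowWeight G θ u v = 0 :=
  if_neg fun h' => h h'.1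

theorem edgeSum_union {w : Fin n → Fin n → ℝ} (hw : ∀ u v, w u v = w v u) {I R : Finset (Fin n)}
    (h : Disjoint I R) :
    edgeSum w (I ∪ R) = edgeSum w I + edgeSum w R + ∑ v ∈ R, ∑ u ∈ I, w v u := by
  simp only [edgeSum, Finset.sum_union h, Finset.sum_add_distrib]
  have : ∑ u ∈ I, ∑ v ∈ R, w u v = ∑ v ∈ R, ∑ u ∈ I, w v u := by
    rw [Finset.sum_comm]
    simp only [hw]
  rw [this]
  ring

variable {G}

theorem isIndepSet_insert_iff {v : Fin n} {S : Finset (Fin n)}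
    (hS : G.IsIndepSet (S : Set (Fin n))) :
    G.IsIndepSet ((insert v S : Finset (Fin n)) : Set (Fin n)) ↔ ∀ w ∈ S, ¬ G.Adj v w := by
  rw [Finset.coe_insert, SimpleGraph.isIndepSet_iff, Set.pairwise_insert]
  constructor
  · rintro ⟨-, h⟩ w hw hvw
    exact (h w hw hvw.ne).1 hvw
  · intro h
    exact ⟨hS, fun w hw _ => ⟨h w hw, fun h' => h w hw h'.symm⟩⟩

theorem IsIndepSet.edgeSum_eq_zero {S : Finset (Fin n)} (hS : G.IsIndepSet (S : Set (Fin n)))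
    {w : Fin n → Fin n → ℝ} (hw : ∀ u v, ¬ G.Adj u v → w u v = 0) : edgeSum w S = 0 := by
  have : ∑ u ∈ S, ∑ v ∈ S, w u v = 0 :=
    Finset.sum_eq_zero fun u hu => Finset.sum_eq_zero fun v hv => hw u v fun h =>
      hS hu hv h.ne h
  rw [edgeSum, this, zero_div]

theorem edgeSum_adjWeight_nonneg (S : Finset (Fin n)) : 0 ≤ edgeSum (adjWeight G) S :=
  div_nonneg (Finset.sum_nonneg fun _ _ => Finset.sum_nonneg fun _ _ => adjWeight_nonneg G _ _)
    zero_le_two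

end

/-- Count by repeated halving the neighbors of `v` in an independent list, where only pairs of
vertices of degree less than `θ` count. -/
noncomputable def countNeighbors (θ : ℝ) (v : Fin n) : ℕ → List (Fin n) → QueryProg n ℝ
  | 0, [] => ret 0
  | 0, w :: _ => ifIndep (insert v {w}) (ret 0) <|
      withDegree v fun d => withDegree w fun d' => ret (if (d : ℝ) < θ ∧ (d' : ℝ) < θ then 1 else 0)
  | h + 1, l => ifIndep (insert v l.toFinset) (ret 0) <|
      (countNeighbors θ v h (l.take (2 ^ h))).bind fun x =>
        (countNeighbors θ v h (l.drop (2 ^ h))).bind fun y => ret (x + y)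

/-- As the list is independent, adding `v` destroys independence exactly when the list contains a
neighbor of `v`. Halving therefore continues only towards actual neighbors, each of which is
responsible for a path of length at most `h` and two degree queries. -/
theorem countNeighbors_spec (G : SimpleGraph (Fin n)) (θ : ℝ) (v : Fin n) (h : ℕ)
    (l : List (Fin n)) (hl : l.length ≤ 2 ^ h) (hI : G.IsIndepSet (l.toFinset : Set (Fin n))) :
    Returns G (countNeighbors θ v h l) (l.map (lowWeight G θ v)).sum ∧
      (countNeighbors θ v h l).cost G ≤ 1 + (2 * h + 2) * (l.map (adjWeight G v)).sum := by
  have hzero : ∀ l : List (Fin n), (∀ w ∈ l, ¬ G.Adj v w) →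
      (l.map (lowWeight G θ v)).sum = 0 ∧ (l.map (adjWeight G v)).sum = 0 := by
    intro l hl
    constructor <;> refine List.sum_eq_zero fun x hx => ?_ <;>
      obtain ⟨w, hw, rfl⟩ := List.mem_map.mp hx
    · exact lowWeight_eq_zero G (hl w hw)
    · exact if_neg (hl w hw)
  induction h generalizing l with
  | zero =>
    rcases l with _ | ⟨w, l⟩
    · exact ⟨Returns.ret _, by simp [countNeighbors, cost]⟩
    · obtain rfl : l = [] := by
        simpa using hl
      have hw : G.IsIndepSet ((insert v {w} : Finset (Fin n)) : Set (Fin n)) ↔ ¬ G.Adj v w := by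
        rw [isIndepSet_insert_iff (by simp)]
        simp
      by_cases hvw : G.Adj v w
      · have hn : ¬ G.IsIndepSet ((insert v {w} : Finset (Fin n)) : Set (Fin n)) := by
          rw [hw]
          exact not_not.mpr hvw
        constructor
        · intro f
          simp only [countNeighbors, mean_ifIndep, if_neg hn, mean_withDegree, mean]
          simp [lowWeight, hvw]
        · simp only [countNeighbors, cost_ifIndep, if_neg hn, cost_withDegree, cost]
          simp [adjWeight, hvw]
          norm_num
      · have hn := hw.mpr hvw
        constructor
        · intro f
          simp only [countNeighbors, mean_ifIndep, if_pos hn, mean]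
          simp [lowWeight, hvw]
        · simp only [countNeighbors, cost_ifIndep, if_pos hn, cost]
          simp [adjWeight, hvw]
  | succ h ih =>
    by_cases hn : G.IsIndepSet ((insert v l.toFinset : Finset (Fin n)) : Set (Fin n))
    · have hz := hzero l fun w hw => (isIndepSet_insert_iff hI).mp hn w (List.mem_toFinset.mpr hw)
      constructor
      · intro f
        simp only [countNeighbors, mean_ifIndep, if_pos hn, mean, hz.1]
      · simp only [countNeighbors, cost_ifIndep, if_pos hn, cost, hz.2]
        simp
    · have hsub : ∀ l' : List (Fin n), l' ⊆ l → G.IsIndepSet (l'.toFinset : Set (Fin n)) :=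
        fun l' hl' => hI.mono (by
          intro x hx
          simp only [Finset.mem_coe, List.mem_toFinset] at hx ⊢
          exact hl' hx)
      obtain ⟨r1, c1⟩ := ih (l.take (2 ^ h)) (List.length_take_le _ _) (hsub _ (List.take_subset _ _))
      obtain ⟨r2, c2⟩ := ih (l.drop (2 ^ h)) (by rw [List.length_drop]; omega)
        (hsub _ (List.drop_subset _ _))
      have hsplit : ∀ g : Fin n → ℝ, (l.map g).sum =
          ((l.take (2 ^ h)).map g).sum + ((l.drop (2 ^ h)).map g).sum := by
        intro g
        rw [← List.sum_append, ← List.map_append, List.take_append_drop]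
      have hone : 1 ≤ (l.map (adjWeight G v)).sum := by
        rw [isIndepSet_insert_iff hI] at hn
        push Not at hn
        obtain ⟨w, hw, hvw⟩ := hn
        have : adjWeight G v w = 1 := if_pos hvw
        rw [← this]
        refine List.single_le_sum ?_ _ (List.mem_map_of_mem (List.mem_toFinset.mp hw))
        intro x hx
        obtain ⟨u, -, rfl⟩ := List.mem_map.mp hx
        exact adjWeight_nonneg G v u
      constructor
      · intro f
        simp only [countNeighbors, mean_ifIndep, if_neg hn]
        rw [hsplit]
        exact r1.bind (Returns.bind r2 (k := fun y => ret (_ + y)) (Returns.ret _)) f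
      · simp only [countNeighbors, cost_ifIndep, if_neg hn, r1.cost_bind, r2.cost_bind, cost]
        have e := hsplit (adjWeight G v)
        push_cast
        -- The two sublists cost two further queries; by `hone` these are absorbed when the
        -- coefficient rises from `2h + 2` to `2h + 4`.
        nlinarith

/-- Extend the independent set `I` greedily by elements of a list; return the extension and the
list of rejected elements. -/
def greedyIndep : ℕ → Finset (Fin n) → List (Fin n) → QueryProg n (Finset (Fin n) × List (Fin n))
  | 0, I, l => ifIndep (I ∪ l.toFinset) (ret (I ∪ l.toFinset, [])) (ret (I, l))
  | h + 1, I, l => ifIndep (I ∪ l.toFinset) (ret (I ∪ l.toFinset, [])) <|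
      (greedyIndep h I (l.take (2 ^ h))).bind fun x =>
        (greedyIndep h x.1 (l.drop (2 ^ h))).bind fun y => ret (y.1, x.2 ++ y.2)

theorem greedyIndep_of_isIndepSet {G : SimpleGraph (Fin n)} (h : ℕ) {I : Finset (Fin n)}
    {l : List (Fin n)} (hn : G.IsIndepSet ((I ∪ l.toFinset : Finset (Fin n)) : Set (Fin n))) :
    Returns G (greedyIndep h I l) (I ∪ l.toFinset, []) ∧ (greedyIndep h I l).cost G = 1 := by
  cases h with
  | zero =>
    exact ⟨fun f => by simp only [greedyIndep, mean_ifIndep, if_pos hn, mean],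
      by simp only [greedyIndep, cost_ifIndep, if_pos hn, cost, add_zero]⟩
  | succ h =>
    exact ⟨fun f => by simp only [greedyIndep, mean_ifIndep, if_pos hn, mean],
      by simp only [greedyIndep, cost_ifIndep, if_pos hn, cost, add_zero]⟩

/-- A failed test forces a rejection somewhere in the block, so the number of failed tests is
controlled by `h` times the number of rejections. A rejected vertex has a neighbor in the
independent set at that moment, and this set only grows. -/
theorem greedyIndep_spec (G : SimpleGraph (Fin n)) (h : ℕ) (I : Finset (Fin n))
    (l : List (Fin n)) (hl : l.length ≤ 2 ^ h) (hnd : l.Nodup) (hd : Disjoint I l.toFinset)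
    (hI : G.IsIndepSet (I : Set (Fin n))) :
    ∃ J R, Returns G (greedyIndep h I l) (J, R) ∧
      (greedyIndep h I l).cost G ≤ 1 + 2 * h * R.length ∧ R.Sublist l ∧ I ⊆ J ∧
      Disjoint J R.toFinset ∧ J ∪ R.toFinset = I ∪ l.toFinset ∧
      G.IsIndepSet (J : Set (Fin n)) ∧ ∀ v ∈ R, ∃ u ∈ J, G.Adj v u := by
  induction h generalizing I l with
  | zero =>
    by_cases hn : G.IsIndepSet ((I ∪ l.toFinset : Finset (Fin n)) : Set (Fin n))
    · obtain ⟨h1, h2⟩ := greedyIndep_of_isIndepSet 0 hn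
      exact ⟨_, _, h1, by simp [h2], List.nil_sublist _, Finset.subset_union_left, by simp,
        by simp, hn, by simp⟩
    rcases l with _ | ⟨w, l⟩
    · exact absurd (by simpa using hI) hn
    · obtain rfl : l = [] := by
        simpa using hl
      refine ⟨I, [w], ?_, ?_, List.Sublist.refl _, subset_rfl, hd, rfl, hI, ?_⟩
      · intro f
        simp only [greedyIndep, mean_ifIndep, if_neg hn, mean]
      · simp only [greedyIndep, cost_ifIndep, if_neg hn, cost]
        simp
      · intro v hv
        obtain rfl : v = w := by simpa using hv
        have e : I ∪ [v].toFinset = insert v I := by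
          ext x
          simp
        rw [e, isIndepSet_insert_iff hI] at hn
        push Not at hn
        exact hn
  | succ h ih =>
    by_cases hn : G.IsIndepSet ((I ∪ l.toFinset : Finset (Fin n)) : Set (Fin n))
    · obtain ⟨h1, h2⟩ := greedyIndep_of_isIndepSet (h + 1) hn
      exact ⟨_, _, h1, by simp [h2], List.nil_sublist _, Finset.subset_union_left, by simp,
        by simp, hn, by simp⟩
    have hl12 : (l.take (2 ^ h)).toFinset ∪ (l.drop (2 ^ h)).toFinset = l.toFinset := by
      rw [← List.toFinset_append, List.take_append_drop]
    have hdisj : Disjoint (l.take (2 ^ h)).toFinset (l.drop (2 ^ h)).toFinset := by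
      rw [List.disjoint_toFinset_iff_disjoint]
      exact List.disjoint_take_drop hnd le_rfl
    rw [← hl12, Finset.disjoint_union_right] at hd
    obtain ⟨J₁, R₁, hr₁, hc₁, hs₁, hIJ₁, hd₁, hu₁, hi₁, ha₁⟩ := ih I (l.take (2 ^ h))
      (List.length_take_le _ _) (hnd.sublist (List.take_sublist _ _)) hd.1 hI
    have hJ₁ : Disjoint J₁ (l.drop (2 ^ h)).toFinset :=
      Disjoint.mono_left (Finset.subset_union_left.trans hu₁.subset)
        (Finset.disjoint_union_left.mpr ⟨hd.2, hdisj⟩)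
    obtain ⟨J₂, R₂, hr₂, hc₂, hs₂, hIJ₂, hd₂, hu₂, hi₂, ha₂⟩ := ih J₁ (l.drop (2 ^ h))
      (by rw [List.length_drop]; omega) (hnd.sublist (List.drop_sublist _ _)) hJ₁ hi₁
    have hR₁ : Disjoint R₁.toFinset (l.drop (2 ^ h)).toFinset :=
      hdisj.mono_left fun x hx => List.mem_toFinset.mpr (hs₁.subset (List.mem_toFinset.mp hx))
    have hunion : J₂ ∪ (R₁ ++ R₂).toFinset = I ∪ l.toFinset := by
      rw [List.toFinset_append, ← hl12, ← Finset.union_assoc I, ← hu₁, Finset.union_right_comm J₁,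
        ← hu₂]
      ext x
      simp only [Finset.mem_union]
      tauto
    have hlen : 1 ≤ R₁.length + R₂.length := by
      by_contra hcon
      have h1 : R₁ = [] := List.eq_nil_of_length_eq_zero (by omega)
      have h2 : R₂ = [] := List.eq_nil_of_length_eq_zero (by omega)
      rw [h1, h2] at hunion
      apply hn
      rw [← hunion]
      simpa using hi₂
    refine ⟨J₂, R₁ ++ R₂, ?_, ?_, ?_, hIJ₁.trans hIJ₂, ?_, hunion, hi₂, ?_⟩
    · intro f
      simp only [greedyIndep, mean_ifIndep, if_neg hn]
      exact hr₁.bind (Returns.bind hr₂ (k := fun y => ret (y.1, R₁ ++ y.2)) (Returns.ret _)) f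
    · simp only [greedyIndep, cost_ifIndep, if_neg hn, hr₁.cost_bind, hr₂.cost_bind, cost]
      have : (1 : ℝ) ≤ R₁.length + R₂.length := by exact_mod_cast hlen
      rw [List.length_append]
      push_cast
      nlinarith
    · have := hs₁.append hs₂
      rwa [List.take_append_drop] at this
    · rw [List.toFinset_append, Finset.disjoint_union_right]
      refine ⟨?_, hd₂⟩
      exact Disjoint.mono_left (Finset.subset_union_left.trans hu₂.subset)
        (Finset.disjoint_union_left.mpr ⟨hd₁, hR₁.symm⟩)
    · intro v hv
      rcases List.mem_append.mp hv with hv | hv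
      · obtain ⟨u, hu, huv⟩ := ha₁ v hv
        exact ⟨u, hIJ₂ hu, huv⟩
      · exact ha₂ v hv

/-- Count the edges between vertices of degree less than `θ` in a list of vertices. The first
argument bounds the depth of the binary searches, the second the number of rounds. -/
noncomputable def countEdges (θ : ℝ) (h : ℕ) : ℕ → List (Fin n) → QueryProg n ℝ
  | 0, _ => ret 0
  | k + 1, l => ifIndep l.toFinset (ret 0) <| (greedyIndep h ∅ l).bind fun x =>
      (sumOver (fun v => countNeighbors θ v h x.1.toList) x.2).bind fun a =>
        (countEdges θ h k x.2).bind fun b => ret (a + b)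

/-- Since `J` is independent, every edge lies either between `R` and `J` or inside `R`. Each
rejected vertex has an edge to `J`, so the round can be charged to the edges between `R` and `J`,
which never reappear in the recursion on `R`. -/
theorem countEdges_spec (G : SimpleGraph (Fin n)) (θ : ℝ) (h k : ℕ) (l : List (Fin n))
    (hnd : l.Nodup) (hk : l.length ≤ k) (hl : l.length ≤ 2 ^ h) :
    Returns G (countEdges θ h k l) (edgeSum (lowWeight G θ) l.toFinset) ∧
      (countEdges θ h k l).cost G ≤ 1 + (4 * h + 5) * edgeSum (adjWeight G) l.toFinset := by
  induction k generalizing l with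
  | zero =>
    obtain rfl : l = [] := List.eq_nil_of_length_eq_zero (by omega)
    constructor
    · intro f
      simp [countEdges, mean, edgeSum]
    · simp [countEdges, cost, edgeSum]
  | succ k ih =>
    by_cases hn : G.IsIndepSet (l.toFinset : Set (Fin n))
    · have h1 := IsIndepSet.edgeSum_eq_zero hn (w := lowWeight G θ)
        fun u v huv => lowWeight_eq_zero G huv
      have h2 := IsIndepSet.edgeSum_eq_zero hn (w := adjWeight G) fun u v huv => if_neg huv
      rw [h1, h2]
      exact ⟨fun f => by simp only [countEdges, mean_ifIndep, if_pos hn, mean],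
        by simp only [countEdges, cost_ifIndep, if_pos hn, cost, mul_zero, le_refl]⟩
    obtain ⟨J, R, hr, hc, hs, -, hd, hu, hi, ha⟩ := greedyIndep_spec G h ∅ l hl hnd (by simp)
      (by simp)
    rw [Finset.empty_union] at hu
    have hRnd : R.Nodup := hnd.sublist hs
    have hJl : J ⊆ l.toFinset := hu ▸ Finset.subset_union_left
    have hJlen : J.toList.length ≤ 2 ^ h := by
      rw [Finset.length_toList]
      exact (Finset.card_le_card hJl).trans ((List.toFinset_card_le l).trans hl)
    have hRne : R ≠ [] := by
      rintro rfl
      apply hn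
      rw [← hu]
      simpa using hi
    -- If every vertex were rejected, then a neighbor in `J` of a rejected vertex would itself lie
    -- in `R`. Hence the rounds end after at most `l.length` steps.
    have hRlt : R.length < l.length := by
      refine lt_of_le_of_ne hs.length_le fun heq => ?_
      obtain ⟨v, hv⟩ := List.exists_mem_of_ne_nil R hRne
      obtain ⟨u, huJ, -⟩ := ha v hv
      have : u ∈ R := (hs.eq_of_length heq) ▸ List.mem_toFinset.mp (hJl huJ)
      exact Finset.disjoint_left.mp hd huJ (List.mem_toFinset.mpr this)
    obtain ⟨hr', hc'⟩ := ih R hRnd (by omega) (by omega)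
    have hcn := fun v => countNeighbors_spec G θ v h J.toList hJlen (by simpa using hi)
    have hsum : Returns G (sumOver (fun v => countNeighbors θ v h J.toList) R)
        (∑ v ∈ R.toFinset, ∑ u ∈ J, lowWeight G θ v u) := by
      have := returns_sumOver (l := R) fun v _ => (hcn v).1
      rw [List.sum_toFinset _ hRnd]
      simpa only [Finset.sum_map_toList] using this
    have hcost : (sumOver (fun v => countNeighbors θ v h J.toList) R).cost G ≤
        R.length + (2 * h + 2) * ∑ v ∈ R.toFinset, ∑ u ∈ J, adjWeight G v u := by
      rw [cost_sumOver, ← List.sum_toFinset _ hRnd]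
      refine (Finset.sum_le_sum fun v _ => (hcn v).2).trans (le_of_eq ?_)
      simp only [Finset.sum_map_toList, Finset.sum_add_distrib, ← Finset.mul_sum, Finset.sum_const,
        nsmul_eq_mul, mul_one, List.toFinset_card_of_nodup hRnd]
    have hRle : (R.length : ℝ) ≤ ∑ v ∈ R.toFinset, ∑ u ∈ J, adjWeight G v u := by
      rw [← List.toFinset_card_of_nodup hRnd, Finset.card_eq_sum_ones, Nat.cast_sum]
      refine Finset.sum_le_sum fun v hv => ?_
      obtain ⟨u, huJ, huv⟩ := ha v (List.mem_toFinset.mp hv)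
      have : adjWeight G v u = 1 := if_pos huv
      rw [Nat.cast_one, ← this]
      exact Finset.single_le_sum (f := fun u => adjWeight G v u)
        (fun u _ => adjWeight_nonneg G v u) huJ
    have hRone : (1 : ℝ) ≤ R.length := by
      exact_mod_cast List.length_pos_iff.mpr hRne
    have hlow := edgeSum_union (lowWeight_comm G θ) hd
    have hadj := edgeSum_union (adjWeight_comm G) hd
    rw [IsIndepSet.edgeSum_eq_zero hi (w := lowWeight G θ)
      fun u v huv => lowWeight_eq_zero G huv, hu, zero_add, add_comm] at hlow
    rw [IsIndepSet.edgeSum_eq_zero hi (w := adjWeight G) fun u v huv => if_neg huv, hu,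
      zero_add] at hadj
    constructor
    · intro f
      simp only [countEdges, mean_ifIndep, if_neg hn]
      rw [hlow]
      exact hr.bind (hsum.bind (Returns.bind hr' (k := fun b => ret (_ + b)) (Returns.ret _))) f
    · simp only [countEdges, cost_ifIndep, if_neg hn, hr.cost_bind, hsum.cost_bind, hr'.cost_bind,
        cost]
      rw [hadj]
      have hh : (0 : ℝ) ≤ h := Nat.cast_nonneg _
      -- With `X` edges between `R` and `J` and `1 ≤ |R| ≤ X`, the round and the constant term of
      -- the recursion cost at most `3 + (4h + 3) X ≤ 1 + (4h + 5) X`.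
      nlinarith

end QueryProg

/-! ### First and second moments for random colorings -/

namespace QueryProg

variable {n N : ℕ}

/-- The average over all colorings of the vertices with `N` colors. -/
noncomputable def colMean (F : (Fin n → Fin N) → ℝ) : ℝ :=
  (∑ c, F c) / Fintype.card (Fin n → Fin N)

theorem colMean_mul_left (a : ℝ) (F : (Fin n → Fin N) → ℝ) :
    colMean (fun c => a * F c) = a * colMean F := by
  rw [colMean, ← Finset.mul_sum, mul_div_assoc, colMean]

theorem colMean_add (F F' : (Fin n → Fin N) → ℝ) :
    colMean (fun c => F c + F' c) = colMean F + colMean F' := by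
  simp only [colMean, Finset.sum_add_distrib, add_div]

theorem colMean_sum {ι : Type*} (s : Finset ι) (F : ι → (Fin n → Fin N) → ℝ) :
    colMean (fun c => ∑ i ∈ s, F i c) = ∑ i ∈ s, colMean (F i) := by
  simp only [colMean]
  rw [Finset.sum_comm, Finset.sum_div]

theorem colMean_mono {F F' : (Fin n → Fin N) → ℝ} (h : ∀ c, F c ≤ F' c) :
    colMean F ≤ colMean F' :=
  div_le_div_of_nonneg_right (Finset.sum_le_sum fun c _ => h c) (Nat.cast_nonneg _)

/-- Exchanging the color of `u` with a spare color is an involution on pairs of a coloring and a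
color. -/
theorem sum_sum_update (u : Fin n) (F : (Fin n → Fin N) → ℝ) :
    ∑ c, ∑ a, F (Function.update c u a) = N * ∑ c, F c := by
  let e : (Fin n → Fin N) × Fin N ≃ (Fin n → Fin N) × Fin N :=
    { toFun := fun x => (Function.update x.1 u x.2, x.1 u)
      invFun := fun x => (Function.update x.1 u x.2, x.1 u)
      left_inv := fun x => by simp
      right_inv := fun x => by simp }
  rw [← Fintype.sum_prod_type' (fun c a => F (Function.update c u a)),
    Fintype.sum_equiv e (fun x => F (Function.update x.1 u x.2)) (fun x => F x.1) fun x => rfl,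
    Fintype.sum_prod_type]
  simp [Finset.mul_sum]

/-- The indicator of the event that the color of `v` is less than `r`. -/
noncomputable def lowColor (r : ℕ) (v : Fin n) (c : Fin n → Fin N) : ℝ :=
  if (c v : ℕ) < r then 1 else 0

/-- The indicator of the event that `u` and `v` have the same color, and it is less than `r`. -/
noncomputable def mono (r : ℕ) (u v : Fin n) (c : Fin n → Fin N) : ℝ :=
  if c u = c v ∧ (c v : ℕ) < r then 1 else 0

theorem mono_comm (r : ℕ) (u v : Fin n) (c : Fin n → Fin N) : mono r u v c = mono r v u c := by
  simp only [mono]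
  congr 1
  apply propext
  constructor <;> rintro ⟨h1, h2⟩ <;> exact ⟨h1.symm, by rwa [h1] at *⟩

variable [NeZero N]

theorem colMean_const (a : ℝ) : colMean (fun _ : Fin n → Fin N => a) = a := by
  rw [colMean, Finset.sum_const, nsmul_eq_mul, Finset.card_univ]
  have : (Fintype.card (Fin n → Fin N) : ℝ) ≠ 0 := by exact_mod_cast Fintype.card_ne_zero
  field_simp

/-- Resampling the color of one vertex does not change the average. -/
theorem colMean_update (u : Fin n) (F : (Fin n → Fin N) → ℝ) :
    colMean F = colMean fun c => (∑ a, F (Function.update c u a)) / N := by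
  have hN : (N : ℝ) ≠ 0 := by exact_mod_cast NeZero.ne N
  simp only [colMean]
  rw [← Finset.sum_div, sum_sum_update]
  field_simp

/-- When the color of `u` is resampled, exactly one of the `N` colors agrees with that of `v`. -/
theorem colMean_mono_mul {r : ℕ} {u v : Fin n} (huv : u ≠ v) {g : (Fin n → Fin N) → ℝ}
    (hg : ∀ c a, g (Function.update c u a) = g c) :
    colMean (fun c => mono r u v c * g c) = colMean (fun c => lowColor r v c * g c) / N := by
  rw [colMean_update u, div_eq_inv_mul, ← colMean_mul_left]
  congr 1
  funext c
  simp only [hg, ← Finset.sum_mul]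
  have : ∑ a, mono r u v (Function.update c u a) = lowColor r v c := by
    simp only [mono, lowColor, Function.update_self, Function.update_of_ne huv.symm]
    by_cases h : (c v : ℕ) < r <;> simp [h]
  rw [this, div_eq_inv_mul]

theorem colMean_lowColor_mul {r : ℕ} (hr : r ≤ N) {v : Fin n} {g : (Fin n → Fin N) → ℝ}
    (hg : ∀ c a, g (Function.update c v a) = g c) :
    colMean (fun c => lowColor r v c * g c) = r / N * colMean g := by
  rw [colMean_update v, ← colMean_mul_left]
  congr 1
  funext c
  simp only [hg, ← Finset.sum_mul]
  have : ∑ a, lowColor r v (Function.update c v a) = r := by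
    simp only [lowColor, Function.update_self]
    rw [Fin.sum_univ_eq_sum_range (fun i => if i < r then (1 : ℝ) else 0), Finset.sum_ite]
    have : (Finset.range N).filter (fun i => i < r) = Finset.range r := by
      ext i
      simp only [Finset.mem_filter, Finset.mem_range]
      omega
    simp [this]
  rw [this]
  ring

theorem colMean_mono_eq {r : ℕ} (hr : r ≤ N) {u v : Fin n} (huv : u ≠ v) :
    colMean (N := N) (mono r u v) = r / N ^ 2 := by
  have h1 := colMean_mono_mul (N := N) (r := r) huv (g := fun _ => 1) fun _ _ => rfl
  have h2 := colMean_lowColor_mul hr (v := v) (g := fun _ => 1) fun _ _ => rfl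
  simp only [mul_one] at h1 h2
  rw [show mono r u v = fun c => mono r u v c from rfl, h1, h2, colMean_const]
  ring

theorem colMean_mono_mul_mono {r : ℕ} (hr : r ≤ N) {u v x : Fin n} (huv : u ≠ v) (hxv : x ≠ v)
    (hux : u ≠ x) : colMean (fun c : Fin n → Fin N => mono r u v c * mono r x v c) = r / N ^ 3 := by
  rw [colMean_mono_mul huv fun c a => by
    simp [mono, Function.update_of_ne hux.symm, Function.update_of_ne huv.symm]]
  have : ∀ c : Fin n → Fin N, lowColor r v c * mono r x v c = mono r x v c := by
    intro c
    by_cases h : (c v : ℕ) < r <;> simp [lowColor, mono, h]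
  simp only [this]
  rw [show (fun c : Fin n → Fin N => mono r x v c) = mono r x v from rfl, colMean_mono_eq hr hxv]
  ring

theorem colMean_mono_mul_mono_of_disjoint {r : ℕ} (hr : r ≤ N) {u v x y : Fin n} (huv : u ≠ v)
    (hxy : x ≠ y) (hux : u ≠ x) (huy : u ≠ y) (hvx : v ≠ x) (hvy : v ≠ y) :
    colMean (fun c : Fin n → Fin N => mono r u v c * mono r x y c) = (r / N ^ 2) ^ 2 := by
  rw [colMean_mono_mul huv fun c a => by
    simp [mono, Function.update_of_ne hux.symm, Function.update_of_ne huy.symm],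
    colMean_lowColor_mul hr fun c a => by
      simp [mono, Function.update_of_ne hvx.symm, Function.update_of_ne hvy.symm],
    colMean_mono_eq hr hxy]
  ring

/-- The covariance of the events that two pairs are monochromatic. -/
theorem colMean_cov_le {r : ℕ} (hr : r ≤ N) {u v x y : Fin n} (huv : u ≠ v) (hxy : x ≠ y) :
    colMean (fun c : Fin n → Fin N => mono r u v c * mono r x y c) - ((r : ℝ) / N ^ 2) ^ 2 ≤
      ((r : ℝ) / N ^ 2 - (r / N ^ 2) ^ 2) *
          ((if u = x then 1 else 0) * (if v = y then 1 else 0) +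
            (if u = y then 1 else 0) * (if v = x then 1 else 0)) +
        ((r : ℝ) / N ^ 3 - (r / N ^ 2) ^ 2) *
          ((if u = x then 1 else 0) + (if u = y then 1 else 0) + (if v = x then 1 else 0) +
            (if v = y then 1 else 0)) := by
  have hN : (1 : ℝ) ≤ N := by exact_mod_cast NeZero.one_le
  have hr' : (r : ℝ) ≤ N := by exact_mod_cast hr
  -- This is the covariance of two pairs with one common vertex. Being nonnegative, its surplus
  -- copies on the right are harmless when the pairs coincide. It vanishes for `r = N`.
  have hγ : (0 : ℝ) ≤ r / N ^ 3 - (r / N ^ 2) ^ 2 := by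
    have : (r : ℝ) / N ^ 3 - (r / N ^ 2) ^ 2 = r * (N - r) / N ^ 4 := by
      field_simp
    rw [this]
    exact div_nonneg (mul_nonneg (Nat.cast_nonneg _) (by linarith)) (by positivity)
  have hsq : ∀ c : Fin n → Fin N, mono r u v c * mono r u v c = mono r u v c := by
    intro c
    simp only [mono]
    split_ifs <;> norm_num
  by_cases h1 : u = x
  · subst h1
    by_cases h2 : v = y
    · subst h2
      simp only [hsq]
      rw [show (fun c : Fin n → Fin N => mono r u v c) = mono r u v from rfl,
        colMean_mono_eq hr huv]
      simp only [huv, huv.symm, if_true, if_false]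
      linarith
    · simp only [mono_comm r u]
      rw [colMean_mono_mul_mono hr huv.symm hxy.symm h2]
      simp only [h2, hxy, huv.symm, if_true, if_false]
      linarith
  · by_cases h2 : v = y
    · subst h2
      rw [colMean_mono_mul_mono hr huv hxy h1]
      simp only [h1, huv, hxy.symm, if_true, if_false]
      linarith
    · by_cases h3 : u = y
      · subst h3
        by_cases h4 : v = x
        · subst h4
          simp only [mono_comm r v, hsq]
          rw [show (fun c : Fin n → Fin N => mono r u v c) = mono r u v from rfl,
            colMean_mono_eq hr huv]
          simp only [huv, huv.symm, if_true, if_false]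
          linarith
        · simp only [mono_comm r u]
          rw [colMean_mono_mul_mono hr huv.symm hxy h4]
          simp only [h1, h2, h4, if_true, if_false]
          linarith
      · by_cases h4 : v = x
        · subst h4
          simp only [mono_comm r v y]
          rw [colMean_mono_mul_mono hr huv hxy.symm h3]
          simp only [h1, h2, h3, if_true, if_false]
          linarith
        · rw [colMean_mono_mul_mono_of_disjoint hr huv hxy h1 h3 h4 h2]
          simp [h1, h2, h3, h4]

/-- The weight of the monochromatic pairs with colors less than `r`. -/
noncomputable def monoSum (w : Fin n → Fin n → ℝ) (r : ℕ) (c : Fin n → Fin N) : ℝ :=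
  (∑ u, ∑ v, w u v * mono r u v c) / 2

theorem colMean_monoSum {w : Fin n → Fin n → ℝ} (hw : ∀ u, w u u = 0) {r : ℕ} (hr : r ≤ N) :
    colMean (N := N) (monoSum w r) = r / N ^ 2 * edgeSum w Finset.univ := by
  have e : monoSum (N := N) w r = fun c => 2⁻¹ * ∑ u, ∑ v, w u v * mono r u v c := by
    funext c
    rw [monoSum, div_eq_inv_mul]
  rw [e, colMean_mul_left, edgeSum]
  simp only [colMean_sum, colMean_mul_left]
  have : ∀ u v, w u v * colMean (N := N) (mono r u v) = r / N ^ 2 * w u v := by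
    intro u v
    by_cases huv : u = v
    · subst huv
      simp [hw]
    · rw [colMean_mono_eq hr huv]
      ring
  simp only [this, ← Finset.mul_sum]
  ring

/-- The variance is a quarter of a sum over two ordered pairs of vertices, weighted by covariances.
Coinciding pairs contribute total weight at most `4e`; each of the four ways of sharing a vertex
contributes at most `2θe`, because the weight at a vertex is at most `θ`. -/
theorem colMean_sq_monoSum_le {w : Fin n → Fin n → ℝ} (hw : ∀ u, w u u = 0)
    (hsymm : ∀ u v, w u v = w v u) (h0 : ∀ u v, 0 ≤ w u v) (h1 : ∀ u v, w u v ≤ 1) {r : ℕ}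
    (hr : r ≤ N) {θ : ℝ} (hθ : ∀ u, ∑ v, w u v ≤ θ) :
    colMean (fun c : Fin n → Fin N =>
        (monoSum w r c - r / N ^ 2 * edgeSum w Finset.univ) ^ 2) ≤
      ((r : ℝ) / N ^ 2 - (r / N ^ 2) ^ 2) * edgeSum w Finset.univ +
        2 * ((r : ℝ) / N ^ 3 - (r / N ^ 2) ^ 2) * θ * edgeSum w Finset.univ := by
  have hN : (1 : ℝ) ≤ N := by exact_mod_cast NeZero.one_le
  have hr' : (r : ℝ) ≤ N := by exact_mod_cast hr
  set q : ℝ := r / N ^ 2 with hq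
  set γ : ℝ := r / N ^ 3 - q ^ 2 with hγdef
  have hγ : 0 ≤ γ := by
    have : γ = r * (N - r) / N ^ 4 := by
      rw [hγdef, hq]
      field_simp
    rw [this]
    exact div_nonneg (mul_nonneg (Nat.cast_nonneg _) (by linarith)) (by positivity)
  have hqq : 0 ≤ q - q ^ 2 := by
    have h1 : q ≤ 1 := by
      rw [hq, div_le_one (by positivity)]
      nlinarith
    have h2 : 0 ≤ q := by positivity
    nlinarith
  set e := edgeSum w Finset.univ with he
  have he2 : ∑ u, ∑ v, w u v = 2 * e := by
    rw [he, edgeSum]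
    ring
  have hmean := colMean_monoSum (N := N) hw hr
  have hvar : colMean (fun c : Fin n → Fin N => (monoSum w r c - q * e) ^ 2) =
      colMean (fun c : Fin n → Fin N => monoSum w r c ^ 2) - (q * e) ^ 2 := by
    have : ∀ c : Fin n → Fin N, (monoSum w r c - q * e) ^ 2 =
        monoSum w r c ^ 2 + ((-2 * (q * e)) * monoSum w r c + (q * e) ^ 2) := fun c => by ring
    simp only [this, colMean_add, colMean_const]
    rw [colMean_mul_left, hmean]
    ring
  have hsq : colMean (fun c : Fin n → Fin N => monoSum w r c ^ 2) =
      4⁻¹ * ∑ u, ∑ v, ∑ x, ∑ y, w u v * w x y *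
        colMean (fun c : Fin n → Fin N => mono r u v c * mono r x y c) := by
    have : ∀ c : Fin n → Fin N, monoSum w r c ^ 2 =
        4⁻¹ * ∑ u, ∑ v, ∑ x, ∑ y, w u v * w x y * (mono r u v c * mono r x y c) := by
      intro c
      have : ∑ u, ∑ v, ∑ x, ∑ y, w u v * w x y * (mono r u v c * mono r x y c) =
          (∑ u, ∑ v, w u v * mono r u v c) * (∑ x, ∑ y, w x y * mono r x y c) := by
        simp only [Finset.sum_mul]
        refine Finset.sum_congr rfl fun u _ => Finset.sum_congr rfl fun v _ => ?_
        simp only [Finset.mul_sum]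
        refine Finset.sum_congr rfl fun x _ => Finset.sum_congr rfl fun y _ => ?_
        ring
      rw [this, monoSum]
      ring
    simp only [this, colMean_mul_left, colMean_sum]
  have hqe : (q * e) ^ 2 = 4⁻¹ * ∑ u, ∑ v, ∑ x, ∑ y, w u v * w x y * q ^ 2 := by
    have : ∑ u, ∑ v, ∑ x, ∑ y, w u v * w x y * q ^ 2 =
        (∑ u, ∑ v, w u v) * (∑ x, ∑ y, w x y) * q ^ 2 := by
      simp only [Finset.sum_mul, Finset.mul_sum]
      refine Finset.sum_congr rfl fun u _ => Finset.sum_congr rfl fun v _ =>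
        Finset.sum_congr rfl fun x _ => Finset.sum_congr rfl fun y _ => ?_
      ring
    rw [this, he2]
    ring
  have hterm : ∀ u v x y, w u v * w x y *
        (colMean (fun c : Fin n → Fin N => mono r u v c * mono r x y c) - q ^ 2) ≤
      (q - q ^ 2) * (w u v * w x y * ((if u = x then 1 else 0) * (if v = y then 1 else 0)) +
            w u v * w x y * ((if u = y then 1 else 0) * (if v = x then 1 else 0))) +
        γ * (w u v * w x y * (if u = x then 1 else 0) + w u v * w x y * (if u = y then 1 else 0) +
          w u v * w x y * (if v = x then 1 else 0) + w u v * w x y * (if v = y then 1 else 0)) := by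
    intro u v x y
    by_cases huv : u = v
    · subst huv
      simp [hw]
    by_cases hxy : x = y
    · subst hxy
      simp [hw]
    have := mul_le_mul_of_nonneg_left (colMean_cov_le (N := N) hr huv hxy)
      (mul_nonneg (h0 u v) (h0 x y))
    refine this.trans (le_of_eq ?_)
    rw [hγdef, hq]
    ring
  have hsame : ∑ u, ∑ v, ∑ x, ∑ y,
      w u v * w x y * ((if u = x then 1 else 0) * (if v = y then 1 else 0)) ≤ 2 * e := by
    rw [← he2]
    refine Finset.sum_le_sum fun u _ => Finset.sum_le_sum fun v _ => ?_
    simp only [mul_ite, mul_one, mul_zero, Finset.sum_ite_eq, Finset.mem_univ, if_true]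
    nlinarith [h0 u v, h1 u v]
  have hsame' : ∑ u, ∑ v, ∑ x, ∑ y,
      w u v * w x y * ((if u = y then 1 else 0) * (if v = x then 1 else 0)) ≤ 2 * e := by
    rw [← he2]
    refine Finset.sum_le_sum fun u _ => Finset.sum_le_sum fun v _ => ?_
    simp only [mul_ite, mul_one, mul_zero, Finset.sum_ite_eq,
      Finset.mem_univ, if_true, Finset.sum_ite_irrel, Finset.sum_const_zero]
    rw [hsymm v u]
    nlinarith [h0 u v, h1 u v]
  have hd0 : ∀ u, 0 ≤ ∑ v, w u v := fun u => Finset.sum_nonneg fun v _ => h0 u v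
  have hdeg : ∑ u, (∑ v, w u v) * (∑ v, w u v) ≤ θ * (2 * e) := by
    rw [← he2, Finset.mul_sum]
    exact Finset.sum_le_sum fun u _ => mul_le_mul_of_nonneg_right (hθ u) (hd0 u)
  have hA : ∑ u, ∑ v, ∑ x, ∑ y, w u v * w x y * (if u = x then 1 else 0) ≤ θ * (2 * e) := by
    refine le_trans (le_of_eq ?_) hdeg
    refine Finset.sum_congr rfl fun u _ => ?_
    simp only [mul_ite, mul_one, mul_zero, Finset.sum_ite_irrel, Finset.sum_const_zero,
      Finset.sum_ite_eq, Finset.mem_univ, if_true, Finset.sum_mul, Finset.mul_sum]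
    exact Finset.sum_comm
  have hB : ∑ u, ∑ v, ∑ x, ∑ y, w u v * w x y * (if u = y then 1 else 0) ≤ θ * (2 * e) := by
    refine le_trans (le_of_eq ?_) hA
    refine Finset.sum_congr rfl fun u _ => Finset.sum_congr rfl fun v _ => ?_
    rw [Finset.sum_comm]
    simp only [hsymm]
  have hC : ∑ u, ∑ v, ∑ x, ∑ y, w u v * w x y * (if v = x then 1 else 0) ≤ θ * (2 * e) := by
    refine le_trans (le_of_eq ?_) hA
    rw [Finset.sum_comm]
    simp only [hsymm]
  have hD : ∑ u, ∑ v, ∑ x, ∑ y, w u v * w x y * (if v = y then 1 else 0) ≤ θ * (2 * e) := by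
    refine le_trans (le_of_eq ?_) hB
    rw [Finset.sum_comm]
    simp only [hsymm]
  have hsum := Finset.sum_le_sum fun u (_ : u ∈ Finset.univ) => Finset.sum_le_sum
    fun v (_ : v ∈ Finset.univ) => Finset.sum_le_sum fun x (_ : x ∈ Finset.univ) =>
      Finset.sum_le_sum fun y (_ : y ∈ Finset.univ) => hterm u v x y
  simp only [Finset.sum_add_distrib, ← Finset.mul_sum, mul_sub, Finset.sum_sub_distrib] at hsum
  rw [hvar, hsq, hqe]
  have b1 := mul_le_mul_of_nonneg_left (add_le_add hsame hsame') hqq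
  have b2 := mul_le_mul_of_nonneg_left (add_le_add (add_le_add (add_le_add hA hB) hC) hD) hγ
  linarith

end QueryProg

/-! ### Estimating the edges between vertices of low degree by coloring -/

namespace QueryProg

variable {n N : ℕ} (G : SimpleGraph (Fin n))

theorem sum_adjWeight (u : Fin n) : ∑ v, adjWeight G u v = G.degree u := by
  simp only [adjWeight]
  rw [Finset.sum_boole, ← SimpleGraph.card_neighborFinset_eq_degree,
    SimpleGraph.neighborFinset_eq_filter]

theorem edgeSum_adjWeight_univ : edgeSum (adjWeight G) Finset.univ = G.edgeSet.ncard := by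
  have h := G.sum_degrees_eq_twice_card_edges
  rw [edgeSum]
  simp only [sum_adjWeight]
  rw [← Nat.cast_sum, h, ← SimpleGraph.coe_edgeFinset, Set.ncard_coe_finset]
  push_cast
  ring

theorem edgeSum_lowWeight_le (θ : ℝ) (S : Finset (Fin n)) :
    edgeSum (lowWeight G θ) S ≤ edgeSum (adjWeight G) S :=
  div_le_div_of_nonneg_right (Finset.sum_le_sum fun _ _ => Finset.sum_le_sum fun _ _ =>
    lowWeight_le G θ _ _) zero_le_two

theorem sum_lowWeight_le {θ : ℝ} (hθ : 0 ≤ θ) (u : Fin n) : ∑ v, lowWeight G θ u v ≤ θ := by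
  by_cases h : (G.degree u : ℝ) < θ
  · refine le_trans ?_ h.le
    rw [← sum_adjWeight]
    exact Finset.sum_le_sum fun v _ => lowWeight_le G θ u v
  · simpa [lowWeight, h] using hθ

section Color

/-- The vertices of a given color. -/
noncomputable def colorClass (c : Fin n → Fin N) (a : ℕ) : List (Fin n) :=
  (List.finRange n).filter fun v => (c v : ℕ) = a

theorem sum_edgeSum_colorClass (w : Fin n → Fin n → ℝ) (r : ℕ) (c : Fin n → Fin N) :
    ((List.range r).map fun a => edgeSum w (colorClass c a).toFinset).sum = monoSum w r c := by
  have hmem : ∀ a, (colorClass c a).toFinset = Finset.univ.filter fun v => (c v : ℕ) = a := by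
    intro a
    ext v
    simp [colorClass]
  rw [← List.sum_toFinset _ List.nodup_range, List.toFinset_range]
  simp only [edgeSum, monoSum, hmem, ← Finset.sum_div, Finset.sum_filter]
  congr 1
  rw [Finset.sum_comm]
  refine Finset.sum_congr rfl fun u _ => ?_
  rw [Finset.sum_ite_eq]
  by_cases hu : (c u : ℕ) < r
  · rw [if_pos (Finset.mem_range.mpr hu)]
    refine Finset.sum_congr rfl fun v _ => ?_
    by_cases h : c u = c v
    · simp [mono, h, h ▸ hu]
    · have h' : ¬ (c v : ℕ) = c u := fun h' => h (Fin.ext h'.symm)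
      simp [mono, h, h']
  · rw [if_neg (by simpa using hu), Finset.sum_eq_zero]
    intro v _
    have : ¬ (c u = c v ∧ (c v : ℕ) < r) := fun h => hu (h.1 ▸ h.2)
    simp [mono, this]

/-- Color the vertices at random with `N` colors, count the monochromatic edges between vertices
of degree less than `θ` in `r` of the colors, and rescale. -/
noncomputable def colorEst (θ : ℝ) (h N : ℕ) [NeZero N] (r : ℕ) : QueryProg n ℝ :=
  (uniform (Fin n → Fin N)).bind fun c =>
    (sumOver (fun a => countEdges θ h n (colorClass c a)) (List.range r)).bind fun x =>
      ret (((r : ℝ) / N ^ 2)⁻¹ * x)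

variable {h : ℕ}

theorem countEdges_colorClass_spec (hn : n ≤ 2 ^ h) (θ : ℝ) (c : Fin n → Fin N) (a : ℕ) :
    Returns G (countEdges θ h n (colorClass c a))
        (edgeSum (lowWeight G θ) (colorClass c a).toFinset) ∧
      (countEdges θ h n (colorClass c a)).cost G ≤
        1 + (4 * h + 5) * edgeSum (adjWeight G) (colorClass c a).toFinset := by
  have hlen : (colorClass c a).length ≤ n := by
    rw [colorClass]
    exact (List.length_filter_le _ _).trans (List.length_finRange).le
  exact countEdges_spec G θ h n _ ((List.nodup_finRange n).filter _) hlen (hlen.trans hn)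

variable [NeZero N]

theorem mean_colorEst (hn : n ≤ 2 ^ h) (θ : ℝ) (r : ℕ) (f : ℝ → ℝ) :
    (colorEst θ h N r).mean G f =
      colMean fun c : Fin n → Fin N =>
        f (((r : ℝ) / N ^ 2)⁻¹ * monoSum (lowWeight G θ) r c) := by
  rw [colorEst, mean_bind, mean_uniform, colMean]
  congr 1
  refine Finset.sum_congr rfl fun c _ => ?_
  have := returns_sumOver (l := List.range r)
    fun a _ => (countEdges_colorClass_spec G hn θ c a).1
  rw [sum_edgeSum_colorClass] at this
  rw [mean_bind, this]
  rfl

/-- Every searched class costs a query even if it is independent. All monochromatic edges have to be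
paid for, including those that the threshold `θ` excludes from the estimate. -/
theorem cost_colorEst_le (hn : n ≤ 2 ^ h) (θ : ℝ) {r : ℕ} (hr : r ≤ N) :
    (colorEst θ h N r : QueryProg n ℝ).cost G ≤
      r + (4 * h + 5) * (r / N ^ 2 * edgeSum (adjWeight G) Finset.univ) := by
  rw [colorEst, cost_bind, cost_uniform, mean_uniform, zero_add]
  change colMean _ ≤ _
  rw [← colMean_monoSum (N := N) (w := adjWeight G) (fun u => if_neg (G.loopless.irrefl u)) hr,
    ← colMean_mul_left]
  have : (r : ℝ) = colMean (fun _ : Fin n → Fin N => (r : ℝ)) := (colMean_const _).symm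
  rw [this, ← colMean_add]
  refine colMean_mono fun c => ?_
  rw [cost_bind]
  simp only [cost, mean_const, add_zero]
  rw [cost_sumOver, ← sum_edgeSum_colorClass]
  refine (List.sum_le_sum fun a _ => (countEdges_colorClass_spec G hn θ c a).2).trans
    (le_of_eq ?_)
  rw [List.sum_map_add, List.sum_map_mul_left]
  simp

/-- The variance of the monochromatic count is multiplied by `(N² / r)²`. The term with `θ`, due to
edges with a common vertex, disappears for `r = N`. -/
theorem mean_sq_colorEst_le (hn : n ≤ 2 ^ h) (θ : ℝ) {r : ℕ} (hr : r ≤ N) (hr0 : 0 < r) (hθ : 0 ≤ θ) :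
    (colorEst θ h N r).mean G (fun x => (x - edgeSum (lowWeight G θ) Finset.univ) ^ 2) ≤
      ((N : ℝ) ^ 2 / r - 1 + 2 * (N / r - 1) * θ) * edgeSum (adjWeight G) Finset.univ := by
  have hN : (0 : ℝ) < N := by exact_mod_cast NeZero.pos N
  have hN1 : (1 : ℝ) ≤ N := by exact_mod_cast NeZero.one_le
  have hr1 : (0 : ℝ) < r := by exact_mod_cast hr0
  have hrN : (r : ℝ) ≤ N := by exact_mod_cast hr
  rw [mean_colorEst G hn]
  set e := edgeSum (lowWeight G θ) Finset.univ with he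
  set q : ℝ := r / N ^ 2 with hq
  have hq0 : q ≠ 0 := by positivity
  have e1 : ∀ c : Fin n → Fin N, (q⁻¹ * monoSum (lowWeight G θ) r c - e) ^ 2 =
      (q⁻¹) ^ 2 * (monoSum (lowWeight G θ) r c - q * e) ^ 2 := by
    intro c
    field_simp
  simp only [e1]
  rw [colMean_mul_left]
  have hvar := colMean_sq_monoSum_le (N := N) (w := lowWeight G θ)
    (fun u => lowWeight_eq_zero G (G.loopless.irrefl u)) (lowWeight_comm G θ)
    (lowWeight_nonneg G θ)
    (fun u v => (lowWeight_le G θ u v).trans (by unfold adjWeight; split_ifs <;> norm_num)) hr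
    (sum_lowWeight_le G hθ)
  rw [← he, ← hq] at hvar
  have e2 : q⁻¹ ^ 2 * ((q - q ^ 2) * e + 2 * (r / N ^ 3 - q ^ 2) * θ * e) =
      ((N : ℝ) ^ 2 / r - 1 + 2 * (N / r - 1) * θ) * e := by
    rw [hq]
    field_simp
  refine (mul_le_mul_of_nonneg_left hvar (by positivity)).trans ?_
  rw [e2]
  refine mul_le_mul_of_nonneg_left (edgeSum_lowWeight_le G θ _) ?_
  have h1 : 1 ≤ (N : ℝ) / r := by rwa [one_le_div hr1]
  have h2 : 1 ≤ (N : ℝ) ^ 2 / r := by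
    rw [one_le_div hr1]
    nlinarith
  have := mul_nonneg (sub_nonneg.mpr h1) hθ
  nlinarith

end Color

/-! ### Estimating the edges with an endpoint of high degree by neighbor sampling -/

section Neighbor

variable (θ : ℝ)

/-- The number of neighbors of `u` of degree at least `θ`. -/
noncomputable def highDegree (u : Fin n) : ℝ :=
  ∑ v, if G.Adj u v ∧ ¬ (G.degree v : ℝ) < θ then 1 else 0

/-- The weight that a vertex gives to its neighbors of degree at least `θ`. -/
noncomputable def halfWeight (θ : ℝ) (d : ℕ) : ℝ := if (d : ℝ) < θ then 1 else 1 / 2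

theorem highDegree_nonneg (u : Fin n) : 0 ≤ highDegree G θ u :=
  Finset.sum_nonneg fun v _ => by split_ifs <;> norm_num

theorem highDegree_eq_zero {u : Fin n} (hu : G.degree u = 0) : highDegree G θ u = 0 := by
  refine Finset.sum_eq_zero fun v _ => if_neg fun h => ?_
  have : 0 < G.degree u := by
    rw [SimpleGraph.degree_pos_iff_exists_adj]
    exact ⟨v, h.1⟩
  omega

/-- An edge between a low and a high vertex is seen only from its low end, with weight `1`. An edge
between two high vertices is seen from both ends, with weight `1/2` each. -/
theorem edgeSum_lowWeight_add :
    edgeSum (lowWeight G θ) Finset.univ + ∑ u, halfWeight θ (G.degree u) * highDegree G θ u =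
      edgeSum (adjWeight G) Finset.univ := by
  have hsymm : ∑ u, ∑ v, (if G.Adj u v ∧ (G.degree u : ℝ) < θ ∧ ¬ (G.degree v : ℝ) < θ
        then (1 : ℝ) else 0) =
      ∑ u, ∑ v, if G.Adj u v ∧ ¬ (G.degree u : ℝ) < θ ∧ (G.degree v : ℝ) < θ then 1 else 0 := by
    rw [Finset.sum_comm]
    refine Finset.sum_congr rfl fun u _ => Finset.sum_congr rfl fun v _ => ?_
    simp only [G.adj_comm v u, and_comm (a := (G.degree v : ℝ) < θ)]
  -- For a single ordered pair the decomposition is off by the orientation of a mixed edge; by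
  -- `hsymm` the two corrections cancel in the sum.
  have hterm : ∀ u v, adjWeight G u v = lowWeight G θ u v +
      2 * (halfWeight θ (G.degree u) * if G.Adj u v ∧ ¬ (G.degree v : ℝ) < θ then 1 else 0) -
      (if G.Adj u v ∧ (G.degree u : ℝ) < θ ∧ ¬ (G.degree v : ℝ) < θ then (1 : ℝ) else 0) +
      (if G.Adj u v ∧ ¬ (G.degree u : ℝ) < θ ∧ (G.degree v : ℝ) < θ then 1 else 0) := by
    intro u v
    by_cases h1 : G.Adj u v <;> by_cases h2 : (G.degree u : ℝ) < θ <;>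
      by_cases h3 : (G.degree v : ℝ) < θ <;>
      simp [adjWeight, lowWeight, halfWeight, h1, h2, h3]
    norm_num
  simp only [edgeSum, highDegree]
  simp only [hterm, Finset.sum_add_distrib, Finset.sum_sub_distrib, ← Finset.mul_sum, hsymm]
  ring

theorem sum_highDegree_le :
    ∑ u, highDegree G θ u ≤ 2 * edgeSum (adjWeight G) Finset.univ := by
  rw [edgeSum, mul_div_cancel₀ _ two_ne_zero]
  refine Finset.sum_le_sum fun u _ => Finset.sum_le_sum fun v _ => ?_
  unfold adjWeight
  split_ifs with h1 h2 <;> first | exact absurd h1.1 h2 | norm_num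

/-- Each such neighbor contributes at least `θ` to the degree sum `2m`. -/
theorem highDegree_le (u : Fin n) (hθ : 0 < θ) :
    highDegree G θ u ≤ 2 * edgeSum (adjWeight G) Finset.univ / θ := by
  rw [le_div_iff₀ hθ, edgeSum, mul_div_cancel₀ _ two_ne_zero, highDegree, Finset.sum_mul]
  refine Finset.sum_le_sum fun v _ => ?_
  rw [sum_adjWeight]
  split_ifs with h
  · rw [one_mul]
    exact not_lt.mp h.2
  · rw [zero_mul]
    positivity

/-- Whether a random neighbor of `u` has degree at least `θ`. -/
noncomputable def probe (u : Fin n) : QueryProg n ℝ :=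
  withNeighbor u fun o => o.elim (ret 0) fun v =>
    withDegree v fun d => ret (if (d : ℝ) < θ then 0 else 1)

theorem cost_probe_le (u : Fin n) : (probe θ u).cost G ≤ 2 := by
  have := cost_withNeighbor_le G u (fun o => o.elim (ret 0) fun v =>
    withDegree v fun d => ret (if (d : ℝ) < θ then (0 : ℝ) else 1)) (c := 1) (by
      rintro (_ | v)
      · simp [cost]
      · simp [cost_withDegree, cost])
  rw [probe]
  linarith

/-- The outcome is `0` or `1`, so one formula serves for both the mean and the second moment. -/
theorem mean_probe {u : Fin n} (hu : G.degree u ≠ 0) (f : ℝ → ℝ) (hf : f 0 = 0) (hf1 : f 1 = 1) :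
    (probe θ u).mean G f = highDegree G θ u / G.degree u := by
  rw [probe, mean_withNeighbor G hu, highDegree, SimpleGraph.neighborFinset_eq_filter,
    Finset.sum_filter]
  congr 1
  refine Finset.sum_congr rfl fun v _ => ?_
  simp only [Option.elim_some, mean_withDegree, mean]
  by_cases h1 : G.Adj u v <;> by_cases h2 : (G.degree v : ℝ) < θ <;> simp [h1, h2, hf, hf1]

/-- One sample of an estimator for the number of edges with an endpoint of degree at least
`θ`. -/
noncomputable def sample [NeZero n] (B : ℕ) : QueryProg n ℝ :=
  (uniform (Fin n)).bind fun u => withDegree u fun d =>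
    if d = 0 then ret 0 else
      (repeatSum (d / B + 1) (probe θ u)).bind fun x =>
        ret (n * halfWeight θ d * d / ((d / B + 1 : ℕ) : ℝ) * x)

variable [NeZero n] {B : ℕ}

theorem mean_id_sample :
    (sample θ B).mean G (fun x => x) = ∑ u, halfWeight θ (G.degree u) * highDegree G θ u := by
  have hn : (n : ℝ) ≠ 0 := by exact_mod_cast NeZero.ne n
  rw [sample, mean_bind, mean_uniform, Fintype.card_fin, div_eq_iff hn, Finset.sum_mul]
  refine Finset.sum_congr rfl fun u _ => ?_
  rw [mean_withDegree]
  split_ifs with hu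
  · simp [mean, highDegree_eq_zero G θ hu]
  · rw [mean_bind]
    simp only [mean]
    rw [mean_mul_left G _ _ fun x => x,
      mean_repeatSum G _ _ (mean_probe G θ hu (fun x => x) rfl rfl)]
    have hd : (G.degree u : ℝ) ≠ 0 := by exact_mod_cast hu
    have hj : ((G.degree u / B + 1 : ℕ) : ℝ) ≠ 0 := by positivity
    field_simp

/-- Let `u` have degree `d` and `H` high neighbors, and let `j` probes be made. The sum of the
probes has second moment at most `jH/d + (jH/d)²`, so after scaling the contribution of `u` is at
most `n² (d/j + H) H`. The choice `j = d / B + 1` gives `d/j ≤ B`, and `H ≤ 2m/θ`. Taking a number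
of probes proportional to the degree is what keeps the first term bounded. -/
theorem mean_sq_sample_le (hθ : 0 < θ) (hB : 0 < B) :
    (sample θ B).mean G (fun x => x ^ 2) ≤
      n * (2 * edgeSum (adjWeight G) Finset.univ) *
        (B + 2 * edgeSum (adjWeight G) Finset.univ / θ) := by
  have hn : (0 : ℝ) < n := by exact_mod_cast NeZero.pos n
  set m := edgeSum (adjWeight G) Finset.univ with hm
  have hm0 : 0 ≤ m := edgeSum_adjWeight_nonneg _
  rw [sample, mean_bind, mean_uniform, Fintype.card_fin, div_le_iff₀ hn]
  have key : ∀ u, (withDegree u fun d => if d = 0 then ret 0 else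
      (repeatSum (d / B + 1) (probe θ u)).bind fun x =>
        ret (n * halfWeight θ d * d / ((d / B + 1 : ℕ) : ℝ) * x)).mean G (fun x => x ^ 2) ≤
      n ^ 2 * (B + 2 * m / θ) * highDegree G θ u := by
    intro u
    have hH0 := highDegree_nonneg G θ u
    rw [mean_withDegree]
    split_ifs with hu
    · simp [mean, highDegree_eq_zero G θ hu]
    · rw [mean_bind]
      simp only [mean, mul_pow, div_pow]
      rw [mean_mul_left]
      have hid := mean_probe G θ hu (fun x => x) rfl rfl
      have hsq := mean_probe G θ hu (fun x => x ^ 2) (by norm_num) (by norm_num)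
      have h1 := mean_sq_sub G _ (mean_repeatSum G (G.degree u / B + 1) _ hid)
      rw [mean_sq_repeatSum G _ _ hid, mean_sq_sub G _ hid, hsq] at h1
      set H := highDegree G θ u
      set d : ℝ := (G.degree u : ℝ) with hd
      set j : ℝ := ((G.degree u / B + 1 : ℕ) : ℝ) with hj
      have hd0 : 0 < d := by
        rw [hd]
        exact_mod_cast Nat.pos_of_ne_zero hu
      have hj0 : 0 < j := by positivity
      have hdj : d ≤ j * B := by
        rw [hd, hj]
        have := Nat.lt_div_mul_add hB (a := G.degree u)
        have h2 : G.degree u ≤ (G.degree u / B + 1) * B := by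
          rw [add_mul, one_mul]
          exact this.le
        exact_mod_cast h2
      have hsqle : (repeatSum (G.degree u / B + 1) (probe θ u)).mean G (fun x => x ^ 2) ≤
          j * (H / d) + (j * (H / d)) ^ 2 := by
        have : 0 ≤ j * (H / d) ^ 2 := by positivity
        linarith
      have hw : halfWeight θ (G.degree u) ^ 2 ≤ 1 := by
        unfold halfWeight
        split_ifs <;> norm_num
      have hHle := highDegree_le G θ u hθ
      have hmn := mean_nonneg G (repeatSum (G.degree u / B + 1) (probe θ u))
        (f := fun x => x ^ 2) fun x => sq_nonneg x
      calc n ^ 2 * halfWeight θ (G.degree u) ^ 2 * d ^ 2 / j ^ 2 * _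
          ≤ n ^ 2 * 1 * d ^ 2 / j ^ 2 * (j * (H / d) + (j * (H / d)) ^ 2) := by gcongr
        _ = n ^ 2 * (d / j + H) * H := by
          field_simp
        _ ≤ n ^ 2 * (B + 2 * m / θ) * H := by
          have : d / j ≤ B := by
            rw [div_le_iff₀ hj0]
            linarith
          gcongr
  refine (Finset.sum_le_sum fun u _ => key u).trans ?_
  rw [← Finset.mul_sum]
  have := mul_le_mul_of_nonneg_left (sum_highDegree_le G θ)
    (show (0 : ℝ) ≤ n ^ 2 * (B + 2 * m / θ) by positivity)
  refine this.trans (le_of_eq ?_)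
  ring

/-- A probe costs at most two queries, so a vertex of degree `d` costs at most `3 + 2d/B`, and the
average degree is `2m/n`. -/
theorem cost_sample_le :
    (sample θ B).cost G ≤ 3 + 4 * edgeSum (adjWeight G) Finset.univ / (n * B) := by
  have hn : (0 : ℝ) < n := by exact_mod_cast NeZero.pos n
  rw [sample, cost_bind, cost_uniform, mean_uniform, Fintype.card_fin, zero_add, div_le_iff₀ hn]
  have key : ∀ u, (withDegree u fun d => if d = 0 then ret 0 else
      (repeatSum (d / B + 1) (probe θ u)).bind fun x =>
        ret (n * halfWeight θ d * d / ((d / B + 1 : ℕ) : ℝ) * x)).cost G ≤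
      3 + 2 / B * G.degree u := by
    intro u
    rw [cost_withDegree]
    split_ifs with hu
    · simp only [cost]
      have : (0 : ℝ) ≤ 2 / B * G.degree u := by positivity
      linarith
    · rw [cost_bind, cost_repeatSum]
      simp only [cost, mean_const]
      have h1 := cost_probe_le G θ u
      have h2 : ((G.degree u / B + 1 : ℕ) : ℝ) ≤ G.degree u / B + 1 := by
        push_cast
        gcongr
        exact Nat.cast_div_le
      have h3 := mul_le_mul h2 h1 (cost_nonneg G _) (by positivity)
      have h4 : (2 : ℝ) / B * G.degree u = G.degree u / B * 2 := by ring
      rw [h4]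
      linarith
  refine (Finset.sum_le_sum fun u _ => key u).trans ?_
  rw [Finset.sum_add_distrib, ← Finset.mul_sum, edgeSum]
  simp only [sum_adjWeight, Finset.sum_const, Finset.card_univ, Fintype.card_fin, nsmul_eq_mul]
  refine le_of_eq ?_
  field_simp
  ring

/-- The average of `s` independent samples. -/
noncomputable def neighborEst (B s : ℕ) : QueryProg n ℝ :=
  (repeatSum s (sample θ B)).bind fun x => ret (x / s)

theorem cost_neighborEst_le (s : ℕ) :
    (neighborEst θ B s).cost G ≤ s * (3 + 4 * edgeSum (adjWeight G) Finset.univ / (n * B)) := by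
  rw [neighborEst, cost_bind, cost_repeatSum]
  simp only [cost, mean_const, add_zero]
  exact mul_le_mul_of_nonneg_left (cost_sample_le G θ) (Nat.cast_nonneg _)

theorem mean_sq_neighborEst_le {s : ℕ} (hs : 0 < s) (hθ : 0 < θ) (hB : 0 < B) :
    (neighborEst θ B s).mean G
        (fun x => (x - ∑ u, halfWeight θ (G.degree u) * highDegree G θ u) ^ 2) ≤
      n * (2 * edgeSum (adjWeight G) Finset.univ) *
        (B + 2 * edgeSum (adjWeight G) Finset.univ / θ) / s := by
  have hs' : (0 : ℝ) < s := by exact_mod_cast hs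
  have hid := mean_id_sample G θ (B := B)
  set μ := ∑ u, halfWeight θ (G.degree u) * highDegree G θ u
  rw [neighborEst, mean_bind]
  simp only [mean]
  have e : ∀ x : ℝ, (x / s - μ) ^ 2 = (s ^ 2 : ℝ)⁻¹ * (x - s * μ) ^ 2 := by
    intro x
    field_simp
  simp only [e]
  rw [mean_mul_left, mean_sq_repeatSum G _ _ hid, mean_sq_sub G _ hid]
  have h1 := mean_sq_sample_le G θ hθ hB
  have e2 : (s ^ 2 : ℝ)⁻¹ * (s * ((sample θ B).mean G (fun x => x ^ 2) - μ ^ 2)) =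
      ((sample θ B).mean G (fun x => x ^ 2) - μ ^ 2) / s := by
    field_simp
  rw [e2]
  gcongr
  nlinarith [sq_nonneg μ]

end Neighbor

end QueryProg

/-! ### The estimators for a given guess -/

namespace QueryProg

variable {n : ℕ} (G : SimpleGraph (Fin n))

/-- The number of colors of the coloring estimator at the guess `β ^ 2` for the number of edges. -/
noncomputable def numColors (ε : ℝ) (β : ℕ) : ℕ := max 1 (min β ⌈ε ^ 2 * β ^ 2 / 20000⌉₊)

instance (ε : ℝ) (β : ℕ) : NeZero (numColors ε β) :=
  ⟨(lt_of_lt_of_le one_pos (le_max_left _ _)).ne'⟩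

/-- The estimator that counts all monochromatic edges. -/
noncomputable def fullEst (ε : ℝ) (h β : ℕ) : QueryProg n ℝ :=
  colorEst n h (numColors ε β) (numColors ε β)

theorem lowWeight_natCast : lowWeight G (n : ℝ) = adjWeight G := by
  funext u v
  have : ∀ u, (G.degree u : ℝ) < n := by
    intro u
    have := G.degree_lt_card_verts u
    rw [Fintype.card_fin] at this
    exact_mod_cast this
  simp [lowWeight, adjWeight, this]

/-- When all classes are searched only the variance `(N - 1) m` remains, and the ceiling in
`numColors` exceeds its argument by less than `1`. -/
theorem mean_sq_fullEst_le {ε : ℝ} {h β : ℕ} (hn : n ≤ 2 ^ h) :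
    (fullEst ε h β).mean G (fun x => (x - edgeSum (adjWeight G) Finset.univ) ^ 2) ≤
      ε ^ 2 * β ^ 2 / 20000 * edgeSum (adjWeight G) Finset.univ := by
  have h1 := mean_sq_colorEst_le G hn (n : ℝ) (le_refl (numColors ε β))
    (NeZero.pos _) (Nat.cast_nonneg n)
  rw [lowWeight_natCast] at h1
  refine h1.trans (mul_le_mul_of_nonneg_right ?_ (edgeSum_adjWeight_nonneg _))
  have hN : (0 : ℝ) < numColors ε β := by exact_mod_cast NeZero.pos (numColors ε β)
  have e : (numColors ε β : ℝ) ^ 2 / numColors ε β - 1 +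
      2 * (numColors ε β / numColors ε β - 1) * n = numColors ε β - 1 := by
    field_simp
    ring
  rw [e]
  have h0 : 0 ≤ ε ^ 2 * (β : ℝ) ^ 2 / 20000 := by positivity
  have h2 : numColors ε β ≤ max 1 ⌈ε ^ 2 * (β : ℝ) ^ 2 / 20000⌉₊ :=
    max_le_max le_rfl (min_le_right _ _)
  have h3 : (numColors ε β : ℝ) ≤ max 1 (⌈ε ^ 2 * (β : ℝ) ^ 2 / 20000⌉₊ : ℝ) := by
    exact_mod_cast h2
  have h4 := Nat.ceil_lt_add_one h0
  rcases max_cases (1 : ℝ) (⌈ε ^ 2 * (β : ℝ) ^ 2 / 20000⌉₊ : ℝ) with h | h <;> linarith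

/-- About `m/N` edges are monochromatic, and `N` is at least the smaller of `β` and `ε²β²/20000`,
whence `1/N ≤ 1/β + 20000/(ε²β²)`. -/
theorem cost_fullEst_le {ε : ℝ} {h β : ℕ} (hn : n ≤ 2 ^ h) (hε : 0 < ε) (hβ : 0 < β) :
    (fullEst ε h β).cost G ≤ β + (4 * h + 5) *
      (edgeSum (adjWeight G) Finset.univ / β ^ 2 * (β + 20000 / ε ^ 2)) := by
  have h1 := cost_colorEst_le G hn (n : ℝ) (le_refl (numColors ε β))
  have hm := edgeSum_adjWeight_nonneg (G := G) Finset.univ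
  set m := edgeSum (adjWeight G) Finset.univ
  have hβ' : (0 : ℝ) < β := by exact_mod_cast hβ
  have hN : (0 : ℝ) < numColors ε β := by exact_mod_cast NeZero.pos (numColors ε β)
  have hNβ : (numColors ε β : ℝ) ≤ β := by
    exact_mod_cast max_le hβ (min_le_left _ _)
  have hinv : (numColors ε β : ℝ) / numColors ε β ^ 2 ≤ (β + 20000 / ε ^ 2) / β ^ 2 := by
    have e : (numColors ε β : ℝ) / numColors ε β ^ 2 = 1 / numColors ε β := by
      field_simp
    rw [e, div_le_div_iff₀ hN (by positivity), one_mul]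
    have hpos : (0 : ℝ) < 20000 / ε ^ 2 := by positivity
    have hmin : (min β ⌈ε ^ 2 * (β : ℝ) ^ 2 / 20000⌉₊ : ℕ) ≤ numColors ε β := le_max_right _ _
    rcases le_total β ⌈ε ^ 2 * (β : ℝ) ^ 2 / 20000⌉₊ with hle | hle
    · rw [min_eq_left hle] at hmin
      have : (β : ℝ) ≤ numColors ε β := by exact_mod_cast hmin
      nlinarith
    · rw [min_eq_right hle] at hmin
      have h2 : ε ^ 2 * (β : ℝ) ^ 2 / 20000 ≤ numColors ε β :=
        (Nat.le_ceil _).trans (by exact_mod_cast hmin)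
      have h3 := mul_le_mul_of_nonneg_left h2 hpos.le
      have h4 : 20000 / ε ^ 2 * (ε ^ 2 * (β : ℝ) ^ 2 / 20000) = β ^ 2 := by
        field_simp
      rw [h4] at h3
      nlinarith
  refine h1.trans (add_le_add hNβ (mul_le_mul_of_nonneg_left ?_ (by positivity)))
  have := mul_le_mul_of_nonneg_right hinv hm
  refine this.trans (le_of_eq ?_)
  ring

/-- The number of color classes to be searched, and of neighbor samples, at level `b`. -/
noncomputable def numSamples (ε : ℝ) (b : ℕ) : ℕ := ⌈20000 * b / ε ^ 2⌉₊

/-- The estimator for the guess `β ^ 2` for the number of edges that is used when `β` is large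
compared with the level `b`. -/
noncomputable def highEst [NeZero n] (ε : ℝ) (h b β : ℕ) [NeZero β] : QueryProg n ℝ :=
  if numSamples ε b ≤ β then
    (colorEst ((b : ℝ) * β / 2) h β (numSamples ε b)).bind fun x =>
      (neighborEst ((b : ℝ) * β / 2) ⌈2 * (β : ℝ) / b⌉₊ (numSamples ε b)).bind fun y =>
        ret (x + y)
  else fullEst ε h β

theorem numSamples_bounds {ε : ℝ} {b : ℕ} (hε : 0 < ε) (hε1 : ε ≤ 1) (hb : 0 < b) :
    20000 * b / ε ^ 2 ≤ numSamples ε b ∧ (numSamples ε b : ℝ) ≤ 40000 * b / ε ^ 2 ∧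
      20000 * (b : ℝ) ≤ 20000 * b / ε ^ 2 ∧ (1 : ℝ) ≤ b := by
  have hb1 : (1 : ℝ) ≤ b := by exact_mod_cast hb
  have h3 : 20000 * (b : ℝ) ≤ 20000 * b / ε ^ 2 := by
    rw [le_div_iff₀ (by positivity)]
    have : ε ^ 2 ≤ 1 := pow_le_one₀ hε.le hε1
    nlinarith
  refine ⟨Nat.le_ceil _, ?_, h3, hb1⟩
  have h1 := (Nat.ceil_lt_add_one (show 0 ≤ 20000 * (b : ℝ) / ε ^ 2 by positivity)).le
  have h2 : 40000 * (b : ℝ) / ε ^ 2 = 20000 * b / ε ^ 2 + 20000 * b / ε ^ 2 := by ring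
  rw [h2]
  unfold numSamples
  linarith

/-- The parameters balance the errors. With `r` of order `b/ε²` and `θ = bβ/2`, the coloring
variance, of order `(β²/r + βθ/r) m`, becomes `ε²β²m`. With `n ≤ βb²` and `B` of order `β/b`, the
sampling variance, of order `nm(B + m/θ)/r`, becomes `ε²m(β² + m)`. -/
theorem mean_sq_highEst_le [NeZero n] {ε : ℝ} {h b β : ℕ} [NeZero β] (hn : n ≤ 2 ^ h)
    (hε : 0 < ε) (hε1 : ε ≤ 1) (hb : 0 < b) (hnb : n ≤ β * b ^ 2) :
    (highEst ε h b β).mean G (fun x => (x - edgeSum (adjWeight G) Finset.univ) ^ 2) ≤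
      ε ^ 2 / 1000 * (edgeSum (adjWeight G) Finset.univ *
        (edgeSum (adjWeight G) Finset.univ + β ^ 2)) := by
  have hm := edgeSum_adjWeight_nonneg (G := G) Finset.univ
  obtain ⟨hr1, hr2, hr3, hb1⟩ := numSamples_bounds hε hε1 hb
  have hβ : (0 : ℝ) < β := by exact_mod_cast NeZero.pos β
  rw [highEst]
  split_ifs with hrβ
  · have hθ : 0 < (b : ℝ) * β / 2 := by positivity
    have hr0' : (0 : ℝ) < numSamples ε b := by linarith
    have hr0 : 0 < numSamples ε b := by exact_mod_cast hr0'
    have hrβ' : (numSamples ε b : ℝ) ≤ β := by exact_mod_cast hrβ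
    have hB : 0 < ⌈2 * (β : ℝ) / b⌉₊ := Nat.ceil_pos.mpr (by positivity)
    have hA := mean_sq_colorEst_le G hn _ hrβ hr0 hθ.le
    have hY := mean_sq_neighborEst_le G _ hr0 hθ hB
    have hsplit := edgeSum_lowWeight_add G ((b : ℝ) * β / 2)
    set m := edgeSum (adjWeight G) Finset.univ
    set e := edgeSum (lowWeight G ((b : ℝ) * β / 2)) Finset.univ
    set t := ∑ u, halfWeight ((b : ℝ) * β / 2) (G.degree u) * highDegree G ((b : ℝ) * β / 2) u
    set r : ℝ := (numSamples ε b : ℝ) with hr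
    rw [mean_bind]
    simp only [mean_bind, mean]
    have hxy : ∀ x y : ℝ, (x + y - m) ^ 2 ≤ 2 * (x - e) ^ 2 + 2 * (y - t) ^ 2 := by
      intro x y
      rw [← hsplit]
      nlinarith [sq_nonneg ((x - e) - (y - t))]
    refine (mean_mono G _ fun x => mean_mono G _ fun y => hxy x y).trans ?_
    simp only [mean_add, mean_mul_left, mean_const]
    have hA' : ((β : ℝ) ^ 2 / r - 1 + 2 * (β / r - 1) * (b * β / 2)) * m ≤
        ε ^ 2 / 10000 * (m * β ^ 2) := by
      have h1 : (β : ℝ) ^ 2 / r - 1 + 2 * (β / r - 1) * (b * β / 2) ≤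
          2 * (b * β ^ 2) * (1 / r) := by
        have h2 : (β : ℝ) ^ 2 / r ≤ b * β ^ 2 * (1 / r) := by
          rw [div_eq_mul_one_div]
          gcongr
          nlinarith [sq_nonneg (β : ℝ)]
        have h3 : 2 * ((β : ℝ) / r - 1) * (b * β / 2) = b * β ^ 2 * (1 / r) - b * β := by ring
        have h4 : (0 : ℝ) < b * β := by positivity
        rw [h3]
        linarith
      have h2 : 1 / r ≤ ε ^ 2 / (20000 * b) := by
        rw [div_le_div_iff₀ hr0' (by positivity)]
        rw [div_le_iff₀ (by positivity)] at hr1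
        linarith
      calc _ ≤ 2 * (b * β ^ 2) * (1 / r) * m := by gcongr
        _ ≤ 2 * (b * β ^ 2) * (ε ^ 2 / (20000 * b)) * m := by gcongr
        _ = ε ^ 2 / 10000 * (m * β ^ 2) := by
          field_simp
          ring
    have hY' : n * (2 * m) * (⌈2 * (β : ℝ) / b⌉₊ + 2 * m / (b * β / 2)) / r ≤
        ε ^ 2 / 2500 * (m * (m + β ^ 2)) := by
      -- Rounding up costs at most `1 ≤ β/b`; here `b ≤ β` because the number of samples is at least
      -- `20000 b` and at most `β`.
      have hceil : (⌈2 * (β : ℝ) / b⌉₊ : ℝ) ≤ 3 * β / b := by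
        have h1 := (Nat.ceil_lt_add_one (show 0 ≤ 2 * (β : ℝ) / b by positivity)).le
        have h2 : 1 ≤ (β : ℝ) / b := by
          rw [one_le_div (by positivity)]
          linarith
        have h3 : 3 * (β : ℝ) / b = 2 * β / b + β / b := by ring
        rw [h3]
        linarith
      have hn' : (n : ℝ) ≤ β * b ^ 2 := by exact_mod_cast hnb
      have h2 : 1 / r ≤ ε ^ 2 / (20000 * b) := by
        rw [div_le_div_iff₀ hr0' (by positivity)]
        rw [div_le_iff₀ (by positivity)] at hr1
        linarith
      rw [div_eq_mul_one_div]
      calc _ ≤ β * b ^ 2 * (2 * m) * (3 * β / b + 2 * m / (b * β / 2)) *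
            (ε ^ 2 / (20000 * b)) := by gcongr
        _ = ε ^ 2 / 20000 * (m * (8 * m + 6 * β ^ 2)) := by
          field_simp
          ring
        _ ≤ ε ^ 2 / 2500 * (m * (m + β ^ 2)) := by
          have : 0 ≤ ε ^ 2 * (m * β ^ 2) := by positivity
          nlinarith
    have : 0 ≤ ε ^ 2 * (m * m) := by positivity
    nlinarith
  · refine (mean_sq_fullEst_le G hn).trans ?_
    set m := edgeSum (adjWeight G) Finset.univ
    have h1 : 0 ≤ ε ^ 2 * (m * m) := by positivity
    have h2 : 0 ≤ ε ^ 2 * (m * β ^ 2) := by positivity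
    nlinarith

theorem cost_highEst_le [NeZero n] {ε : ℝ} {h b β : ℕ} [NeZero β] (hn : n ≤ 2 ^ h)
    (hε : 0 < ε) (hε1 : ε ≤ 1) (hb : 0 < b) (hnb : (β - 1) * b ^ 2 ≤ n) :
    (highEst ε h b β).cost G ≤ 80000 * (4 * h + 5) * b / ε ^ 2 *
      (1 + edgeSum (adjWeight G) Finset.univ / β ^ 2) := by
  have hm := edgeSum_adjWeight_nonneg (G := G) Finset.univ
  obtain ⟨hr1, hr2, hr3, hb1⟩ := numSamples_bounds hε hε1 hb
  have hβ : (0 : ℝ) < β := by exact_mod_cast NeZero.pos β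
  have hh : (0 : ℝ) ≤ h := Nat.cast_nonneg h
  have hE : (0 : ℝ) < b / ε ^ 2 := by positivity
  have e1 : 40000 * (b : ℝ) / ε ^ 2 = 40000 * (b / ε ^ 2) := by ring
  have e2 : 80000 * (4 * (h : ℝ) + 5) * b / ε ^ 2 = 80000 * (4 * h + 5) * (b / ε ^ 2) := by ring
  rw [e1] at hr2
  rw [e2]
  rw [highEst]
  split_ifs with hrβ
  · have hA := cost_colorEst_le G hn ((b : ℝ) * β / 2) hrβ
    have hY := cost_neighborEst_le G ((b : ℝ) * β / 2) (B := ⌈2 * (β : ℝ) / b⌉₊) (numSamples ε b)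
    rw [cost_bind]
    simp only [cost_bind, cost, mean_const, add_zero]
    set m := edgeSum (adjWeight G) Finset.univ
    have hrβ' : (numSamples ε b : ℝ) ≤ β := by exact_mod_cast hrβ
    set r : ℝ := (numSamples ε b : ℝ) with hr
    have hβ2 : (2 : ℝ) ≤ β := by linarith
    have hn0 : (0 : ℝ) < n := by exact_mod_cast NeZero.pos n
    have hn' : (β : ℝ) / 2 * b ^ 2 ≤ n := by
      have h1 : ((β - 1 : ℕ) : ℝ) * b ^ 2 ≤ n := by exact_mod_cast hnb
      rw [Nat.cast_sub NeZero.one_le, Nat.cast_one] at h1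
      refine le_trans ?_ h1
      gcongr
      linarith
    have hB : 2 * (β : ℝ) / b ≤ ⌈2 * (β : ℝ) / b⌉₊ := Nat.le_ceil _
    -- Since `β ≥ 2`, the lower bound on `n` gives `n ≥ βb²/2`, so `n` times the batch size is at
    -- least `β² b ≥ β²`.
    have hden : 4 * m / (n * ⌈2 * (β : ℝ) / b⌉₊) ≤ 4 * (m / β ^ 2) := by
      rw [mul_div_assoc]
      gcongr
      calc (β : ℝ) ^ 2 ≤ β ^ 2 * b := by nlinarith [sq_nonneg (β : ℝ)]
        _ = ((β : ℝ) / 2 * b ^ 2) * (2 * β / b) := by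
          field_simp
        _ ≤ (n : ℝ) * (⌈2 * (β : ℝ) / b⌉₊ : ℝ) := by gcongr
    set x := m / (β : ℝ) ^ 2 with hx
    have hx0 : 0 ≤ x := by positivity
    have e3 : r / β ^ 2 * m = r * x := by
      rw [hx]
      ring
    rw [e3] at hA
    have hr0 : 0 ≤ r := Nat.cast_nonneg _
    have hY2 := hY.trans (mul_le_mul_of_nonneg_left (add_le_add_right hden 3) hr0)
    have h5 : r * (4 + (4 * h + 9) * x) ≤ 40000 * (b / ε ^ 2) * (2 * (4 * h + 5) * (1 + x)) := by
      gcongr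
      nlinarith [mul_nonneg hh hx0]
    nlinarith
  -- Here `β` is smaller than the number of samples, so searching all classes stays within a budget
  -- of order `b/ε²`.
  · have hA := cost_fullEst_le G (h := h) hn hε (NeZero.pos β)
    set m := edgeSum (adjWeight G) Finset.univ
    set x := m / (β : ℝ) ^ 2 with hx
    have hx0 : 0 ≤ x := by positivity
    have hβr : (β : ℝ) ≤ 40000 * (b / ε ^ 2) :=
      le_trans (by exact_mod_cast (not_le.mp hrβ).le) hr2
    have h20 : 20000 / ε ^ 2 ≤ 20000 * (b / ε ^ 2) := by
      rw [mul_div_assoc']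
      gcongr
      linarith
    calc _ ≤ β + (4 * h + 5) * (x * (β + 20000 / ε ^ 2)) := hA
      _ ≤ 40000 * (b / ε ^ 2) + (4 * h + 5) *
          (x * (40000 * (b / ε ^ 2) + 20000 * (b / ε ^ 2))) := by gcongr
      _ ≤ _ := by
        have h1 := mul_nonneg hE.le hx0
        have h2 := mul_nonneg hE.le hh
        have h3 := mul_nonneg h1 hh
        nlinarith

end QueryProg

/-! ### The sequence of guesses and the critical level -/

/-- The guess for the square root of the number of edges at level `i` of the search from above. -/
def topGuess (n i : ℕ) : ℕ := (n - 1) / 4 ^ i + 1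

instance (n i : ℕ) : NeZero (topGuess n i) := ⟨Nat.succ_ne_zero _⟩

theorem topGuess_le_four_mul (n i : ℕ) : topGuess n i ≤ 4 * topGuess n (i + 1) := by
  unfold topGuess
  rw [pow_succ, ← Nat.div_div_eq_div_mul]
  omega

theorem two_mul_topGuess_le {n i : ℕ} (h : 2 ≤ topGuess n (i + 1)) :
    2 * topGuess n (i + 1) ≤ topGuess n i := by
  unfold topGuess at *
  rw [pow_succ, ← Nat.div_div_eq_div_mul] at *
  omega

theorem le_topGuess_mul {n : ℕ} (i : ℕ) : n ≤ topGuess n i * (2 ^ i) ^ 2 := by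
  have h : (2 ^ i) ^ 2 = 4 ^ i := by
    rw [← pow_mul, mul_comm, pow_mul]
    norm_num
  rw [h, topGuess]
  have := Nat.lt_div_mul_add (a := n - 1) (b := 4 ^ i) (by positivity)
  rw [add_mul, one_mul]
  omega

theorem topGuess_sub_one_mul_le {n : ℕ} (i : ℕ) : (topGuess n i - 1) * (2 ^ i) ^ 2 ≤ n := by
  have h : (2 ^ i) ^ 2 = 4 ^ i := by
    rw [← pow_mul, mul_comm, pow_mul]
    norm_num
  rw [h, topGuess, Nat.add_sub_cancel]
  exact (Nat.div_mul_le_self _ _).trans (Nat.sub_le _ _)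

/-- The level at which the searches from below and from above find a number `m`. -/
theorem exists_level {n : ℕ} {m : ℝ} (hn : 1 ≤ n) (hm : 1 ≤ m) (hmn : m ≤ n ^ 2) :
    ∃ l : ℕ, l ≤ n ∧ (4 : ℝ) ^ l ≤ 4 * m ∧ (4 : ℝ) ^ l * √m ≤ 8 * n ∧
      (∀ j < l, m * 4 ^ l ≤ 4 * 4 ^ j * (topGuess n j : ℝ) ^ 2 ∧ m ≤ (topGuess n j : ℝ) ^ 2) ∧
      (∀ i, l ≤ i → m ≤ 4 ^ i ∨ (topGuess n i : ℝ) ^ 2 ≤ m) ∧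
      ∀ j, m ≤ 16 ^ (j + 1) * (topGuess n (l + j) : ℝ) ^ 2 := by
  have hn4 : m ≤ 4 ^ n := by
    refine hmn.trans ?_
    have h2 : (n : ℝ) ≤ 2 ^ n := by exact_mod_cast Nat.lt_two_pow_self.le
    calc (n : ℝ) ^ 2 ≤ (2 ^ n) ^ 2 := by gcongr
      _ = 4 ^ n := by
        rw [← pow_mul, mul_comm, pow_mul]
        norm_num
  have hex : ∃ i : ℕ, m ≤ 4 ^ i ∨ (topGuess n i : ℝ) ^ 2 ≤ m := ⟨n, Or.inl hn4⟩
  classical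
  -- The first level at which the lower guess `4 ^ i` or the upper guess `(topGuess n i)²` has
  -- crossed `m`.
  set l := Nat.find hex with hl
  have hmin : ∀ j < l, (4 : ℝ) ^ j < m ∧ m < (topGuess n j : ℝ) ^ 2 := by
    intro j hj
    have := Nat.find_min hex hj
    push Not at this
    exact this
  have hstep : ∀ i, (topGuess n i : ℝ) ≤ 4 * topGuess n (i + 1) := by
    intro i
    exact_mod_cast topGuess_le_four_mul n i
  -- The square of the upper guess still exceeds `m ≥ 1`. This excludes the floor value `1`, where
  -- the sequence stops decreasing.
  have htwo : ∀ j < l, 2 ≤ topGuess n j := by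
    intro j hj
    by_contra hcon
    have h1 : (topGuess n j : ℝ) ≤ 1 := by
      have : topGuess n j ≤ 1 := by omega
      exact_mod_cast this
    have h2 : (0 : ℝ) ≤ topGuess n j := Nat.cast_nonneg _
    have := (hmin j hj).2
    nlinarith
  refine ⟨l, Nat.find_min' hex (Or.inl hn4), ?_, ?_, ?_, ?_, ?_⟩
  · rcases Nat.eq_zero_or_pos l with h0 | h0
    · rw [h0, pow_zero]
      linarith
    · obtain ⟨k, hk⟩ : ∃ k, l = k + 1 := ⟨l - 1, by omega⟩
      have := (hmin k (by omega)).1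
      rw [hk, pow_succ]
      linarith
  · have hsq : √m ≤ n := by
      rw [Real.sqrt_le_left (Nat.cast_nonneg n)]
      exact hmn
    rcases Nat.eq_zero_or_pos l with h0 | h0
    · rw [h0, pow_zero, one_mul]
      have : (0 : ℝ) ≤ n := Nat.cast_nonneg _
      linarith
    · obtain ⟨k, hk⟩ : ∃ k, l = k + 1 := ⟨l - 1, by omega⟩
      have h1 : √m ≤ topGuess n k := by
        rw [Real.sqrt_le_left (Nat.cast_nonneg _)]
        exact (hmin k (by omega)).2.le
      have h2 := htwo k (by omega)
      have h3 := topGuess_sub_one_mul_le (n := n) k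
      have h4 : topGuess n k * 4 ^ k ≤ 2 * n := by
        have h : (2 ^ k) ^ 2 = 4 ^ k := by
          rw [← pow_mul, mul_comm, pow_mul]
          norm_num
        rw [h] at h3
        have : topGuess n k ≤ 2 * (topGuess n k - 1) := by omega
        calc topGuess n k * 4 ^ k ≤ 2 * (topGuess n k - 1) * 4 ^ k := Nat.mul_le_mul_right _ this
          _ = 2 * ((topGuess n k - 1) * 4 ^ k) := by ring
          _ ≤ 2 * n := Nat.mul_le_mul_left _ h3
      have h5 : (topGuess n k : ℝ) * 4 ^ k ≤ 2 * n := by exact_mod_cast h4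
      have h6 : (0 : ℝ) < 4 ^ k := by positivity
      rw [hk, pow_succ]
      nlinarith
  · intro j hj
    refine ⟨?_, (hmin j hj).2.le⟩
    -- Going back from level `l - 1`, where the squared guess is still above `m`, it gains a factor
    -- of at least `4` per level.
    have key : ∀ d j, j + d + 1 = l → m * 4 ^ d ≤ (topGuess n j : ℝ) ^ 2 := by
      intro d
      induction d with
      | zero =>
        intro j hj
        rw [pow_zero, mul_one]
        exact (hmin j (by omega)).2.le
      | succ d ih =>
        intro j hj
        have h1 := ih (j + 1) (by omega)
        have h2 : 2 * (topGuess n (j + 1) : ℝ) ≤ topGuess n j := by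
          exact_mod_cast two_mul_topGuess_le (htwo (j + 1) (by omega))
        have h3 : (0 : ℝ) ≤ topGuess n (j + 1) := Nat.cast_nonneg _
        rw [pow_succ]
        nlinarith
    obtain ⟨d, hd⟩ : ∃ d, j + d + 1 = l := ⟨l - j - 1, by omega⟩
    have h1 := key d j hd
    have h2 : (4 : ℝ) ^ l = 4 * 4 ^ j * 4 ^ d := by
      rw [← hd]
      ring
    rw [h2]
    have h3 : (0 : ℝ) < 4 * 4 ^ j := by positivity
    nlinarith
  · intro i hi
    have hspec := Nat.find_spec hex
    rcases hspec with h | h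
    · exact Or.inl (h.trans (pow_le_pow_right₀ (by norm_num) hi))
    · refine Or.inr (le_trans ?_ h)
      have : topGuess n i ≤ topGuess n l :=
        Nat.add_le_add_right (Nat.div_le_div_left (Nat.pow_le_pow_right (by norm_num) hi)
          (by positivity)) 1
      have h2 : (topGuess n i : ℝ) ≤ topGuess n l := by exact_mod_cast this
      gcongr
  · have hbase : m ≤ 16 * (topGuess n l : ℝ) ^ 2 := by
      rcases Nat.eq_zero_or_pos l with h0 | h0
      · have : topGuess n 0 = n := by
          unfold topGuess
          rw [pow_zero, Nat.div_one]
          omega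
        rw [h0, this]
        nlinarith [sq_nonneg (n : ℝ)]
      · obtain ⟨k, hk⟩ : ∃ k, l = k + 1 := ⟨l - 1, by omega⟩
        have h1 := (hmin k (by omega)).2
        have h2 := hstep k
        have h3 : (0 : ℝ) ≤ topGuess n k := Nat.cast_nonneg _
        rw [hk]
        nlinarith
    intro j
    induction j with
    | zero => simpa using hbase
    | succ j ih =>
      have h2 := hstep (l + j)
      have h3 : (0 : ℝ) ≤ topGuess n (l + j) := Nat.cast_nonneg _
      have h4 : (topGuess n (l + j) : ℝ) ^ 2 ≤ 16 * (topGuess n (l + (j + 1)) : ℝ) ^ 2 := by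
        rw [← add_assoc]
        nlinarith
      have h5 : (0 : ℝ) < 16 ^ (j + 1) := by positivity
      rw [pow_succ]
      nlinarith

/-! ### The simultaneous search from below and from above -/

namespace QueryProg

variable {n : ℕ} (G : SimpleGraph (Fin n))

/-- Run `P` and return its output if it is at most `a`; otherwise run `Q` and return its output if
it is at least `b`; otherwise run `R`. -/
noncomputable def firstOf (P : QueryProg n (Option ℝ)) (a : ℝ) (Q : QueryProg n ℝ) (b : ℝ)
    (R : QueryProg n ℝ) : QueryProg n ℝ :=
  P.bind fun o =>
    if ∃ x ∈ o, x ≤ a then ret (o.getD 0)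
    else Q.bind fun y => if b ≤ y then ret y else R

/-- The probability that the output of `P` is rejected by `firstOf`. -/
noncomputable def belowReject (P : QueryProg n (Option ℝ)) (a : ℝ) : ℝ :=
  P.mean G fun o => if ∃ x ∈ o, x ≤ a then 0 else 1

/-- The probability that the output of `Q` is rejected by `firstOf`. -/
noncomputable def aboveReject (Q : QueryProg n ℝ) (b : ℝ) : ℝ :=
  Q.mean G ({y | ¬ b ≤ y}.indicator 1)

theorem mean_le_one {α : Type} (p : QueryProg n α) {f : α → ℝ} (h : ∀ a, f a ≤ 1) :
    p.mean G f ≤ 1 := by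
  simpa [mean_const] using mean_mono G p h

theorem indicator_one_nonneg {γ : Type*} (S : Set γ) (x : γ) : 0 ≤ S.indicator (1 : γ → ℝ) x :=
  Set.indicator_nonneg (fun _ _ => zero_le_one) x

theorem indicator_one_le_one {γ : Type*} (S : Set γ) (x : γ) : S.indicator (1 : γ → ℝ) x ≤ 1 :=
  Set.indicator_le' (fun _ _ => le_rfl) (fun _ _ => zero_le_one) x

theorem belowReject_nonneg (P : QueryProg n (Option ℝ)) (a : ℝ) : 0 ≤ belowReject G P a :=
  mean_nonneg G P fun o => by split_ifs <;> norm_num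

theorem belowReject_le_one (P : QueryProg n (Option ℝ)) (a : ℝ) : belowReject G P a ≤ 1 :=
  mean_le_one G P fun o => by split_ifs <;> norm_num

theorem aboveReject_nonneg (Q : QueryProg n ℝ) (b : ℝ) : 0 ≤ aboveReject G Q b :=
  mean_nonneg G Q (indicator_one_nonneg _)

theorem aboveReject_le_one (Q : QueryProg n ℝ) (b : ℝ) : aboveReject G Q b ≤ 1 :=
  mean_le_one G Q (indicator_one_le_one _)

theorem cost_firstOf_le (P : QueryProg n (Option ℝ)) (a : ℝ) (Q : QueryProg n ℝ) (b : ℝ)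
    (R : QueryProg n ℝ) :
    (firstOf P a Q b R).cost G ≤
      P.cost G + Q.cost G + belowReject G P a * aboveReject G Q b * R.cost G := by
  have hQ : (Q.bind fun y => if b ≤ y then ret y else R).cost G =
      Q.cost G + aboveReject G Q b * R.cost G := by
    rw [cost_bind, aboveReject, mul_comm _ (R.cost G), ← mean_mul_left]
    congr 2
    funext y
    by_cases h : b ≤ y
    · rw [if_pos h, Set.indicator_of_notMem (by simpa using h), mul_zero]
      rfl
    · rw [if_neg h, Set.indicator_of_mem (by simpa using h), Pi.one_apply, mul_one]
  have hP : (firstOf P a Q b R).cost G =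
      P.cost G + belowReject G P a * (Q.cost G + aboveReject G Q b * R.cost G) := by
    rw [firstOf, cost_bind, belowReject, mul_comm _ (Q.cost G + _), ← mean_mul_left, ← hQ]
    congr 2
    funext o
    split_ifs
    · rw [mul_zero]
      rfl
    · rw [mul_one]
  rw [hP]
  nlinarith [belowReject_le_one G P a, cost_nonneg G Q]

/-- For `P` the acceptance test is dropped, since the lower estimator is rarely wrong at small
guesses anyway. For `Q` it is kept: with a guess far above `m` the upper estimator can be
inaccurate, and only the test makes accepting a wrong value unlikely. -/
theorem mean_firstOf_le (P : QueryProg n (Option ℝ)) (a : ℝ) (Q : QueryProg n ℝ) (b : ℝ)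
    (R : QueryProg n ℝ) (S : Set ℝ) :
    (firstOf P a Q b R).mean G (S.indicator 1) ≤
      P.mean G (fun o => o.elim 0 (S.indicator 1)) + Q.mean G ((S ∩ {y | b ≤ y}).indicator 1) +
        belowReject G P a * aboveReject G Q b * R.mean G (S.indicator 1) := by
  have hQ : (Q.bind fun y => if b ≤ y then ret y else R).mean G (S.indicator 1) =
      Q.mean G ((S ∩ {y | b ≤ y}).indicator 1) +
        aboveReject G Q b * R.mean G (S.indicator 1) := by
    rw [mean_bind, aboveReject, mul_comm _ (R.mean G _), ← mean_mul_left, ← mean_add]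
    congr 1
    funext y
    by_cases h : b ≤ y
    · have h1 : y ∉ {y | ¬ b ≤ y} := fun h' => h' h
      rw [if_pos h, Set.indicator_of_notMem h1, mul_zero, add_zero]
      by_cases hS : y ∈ S
      · rw [Set.indicator_of_mem (show y ∈ S ∩ {y | b ≤ y} from ⟨hS, h⟩)]
        simp [mean, hS]
      · rw [Set.indicator_of_notMem fun h' => hS h'.1]
        simp [mean, hS]
    · have h1 : y ∈ {y | ¬ b ≤ y} := h
      rw [if_neg h, Set.indicator_of_mem h1, Pi.one_apply, mul_one,
        Set.indicator_of_notMem fun h' => h h'.2, zero_add]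
  have hrest := mean_nonneg G (Q.bind fun y => if b ≤ y then ret y else R)
    (indicator_one_nonneg S)
  have hP : (firstOf P a Q b R).mean G (S.indicator 1) ≤
      P.mean G (fun o => o.elim 0 (S.indicator 1)) + belowReject G P a *
        (Q.bind fun y => if b ≤ y then ret y else R).mean G (S.indicator 1) := by
    rw [firstOf, mean_bind, belowReject, mul_comm _ ((Q.bind _).mean G _), ← mean_mul_left,
      ← mean_add]
    refine mean_mono G P fun o => ?_
    split_ifs with h
    · obtain ⟨x, hx, -⟩ := h
      obtain rfl : o = some x := hx
      simp [mean]
    · rw [mul_one]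
      have : 0 ≤ o.elim 0 (S.indicator (1 : ℝ → ℝ)) := by
        cases o with
        | none => exact le_rfl
        | some x => exact indicator_one_nonneg S x
      linarith
  refine hP.trans ?_
  rw [hQ]
  have h1 := mean_nonneg G Q (indicator_one_nonneg (S ∩ {y | b ≤ y}))
  nlinarith [belowReject_le_one G P a]

/-- The budget of queries for the estimator from below at level `i`. -/
noncomputable def budget (ε : ℝ) (h i : ℕ) : ℕ :=
  ⌈5120000 * (4 * (h : ℝ) + 5) * 2 ^ i / ε ^ 2⌉₊

/-- The estimator from below at level `i`. -/
noncomputable def belowEst (ε : ℝ) (h i : ℕ) : QueryProg n (Option ℝ) :=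
  (fullEst ε h (2 ^ i)).trunc (budget ε h i)

/-- The estimator from above at level `i`. -/
noncomputable def aboveEst [NeZero n] (ε : ℝ) (h i : ℕ) : QueryProg n ℝ :=
  highEst ε h (2 ^ i) (topGuess n i)

/-- Search for the number of edges from below and from above at the same time, for a given number
of levels from level `i` on. -/
noncomputable def search [NeZero n] (ε : ℝ) (h : ℕ) : ℕ → ℕ → QueryProg n ℝ
  | 0, _ => ret 0
  | k + 1, i => firstOf (belowEst ε h i) (2 * 4 ^ i) (aboveEst ε h i)
      ((topGuess n i : ℝ) ^ 2 / 2) (search ε h k (i + 1))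

section Level

variable {ε : ℝ} {h : ℕ} (i : ℕ)

theorem two_pow_sq : ((2 ^ i : ℕ) : ℝ) ^ 2 = 4 ^ i := by
  push_cast
  rw [← pow_mul, mul_comm, pow_mul]
  norm_num

/-- The variance is proportional to the guess `4 ^ i`, so the relative accuracy is best when the
guess is far below `m`. Truncation, which bounds the cost in that range, only removes outputs. -/
theorem mean_belowEst_le (hn : n ≤ 2 ^ h) (hε : 0 < ε) {m : ℝ}
    (hm : edgeSum (adjWeight G) Finset.univ = m) (hm1 : 1 ≤ m) :
    (belowEst ε h i).mean G
        (fun o => o.elim 0 ((Set.Icc ((1 - ε) * m) ((1 + ε) * m))ᶜ.indicator 1)) ≤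
      4 ^ i / (20000 * m) := by
  refine (mean_trunc_le G _ _ (indicator_one_nonneg _)).trans ?_
  have hv := mean_sq_fullEst_le G (ε := ε) (β := 2 ^ i) hn
  rw [hm, two_pow_sq] at hv
  have := mul_mean_indicator_le G _ (t := ε * m) (S := (Set.Icc ((1 - ε) * m) ((1 + ε) * m))ᶜ)
    (by positivity) hv (by
      intro x hx
      by_contra hcon
      push Not at hcon
      rw [abs_lt] at hcon
      exact hx ⟨by linarith, by linarith⟩)
  rw [le_div_iff₀ (by positivity)]
  have hpos : 0 < ε ^ 2 * m := by positivity
  refine le_of_mul_le_mul_left ?_ hpos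
  linarith

/-- An output above twice the guess has probability at most `1/20000` by Chebyshev. The budget is
`128` times a bound for the expected cost when `m ≤ 4 ^ i`, so by Markov it is exceeded with
probability at most `1/128`. -/
theorem belowReject_belowEst_le (hn : n ≤ 2 ^ h) (hε : 0 < ε) (hε1 : ε ≤ 1) {m : ℝ}
    (hm : edgeSum (adjWeight G) Finset.univ = m) (hm1 : 1 ≤ m) (hmi : m ≤ 4 ^ i) :
    belowReject G (belowEst ε h i) (2 * 4 ^ i) ≤ 1 / 64 := by
  have hv := mean_sq_fullEst_le G (ε := ε) (β := 2 ^ i) hn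
  have hc := cost_fullEst_le G (ε := ε) (h := h) (β := 2 ^ i) hn hε (by positivity)
  rw [hm, two_pow_sq] at hv hc
  have h4 : (0 : ℝ) < 4 ^ i := by positivity
  have hε2 : ε ^ 2 ≤ 1 := pow_le_one₀ hε.le hε1
  have hcheb := mul_mean_indicator_le G _ (t := 4 ^ i) (S := {x | ¬ x ≤ 2 * 4 ^ i})
    h4.le hv (by
      intro x hx
      simp only [Set.mem_ofPred_eq, not_le] at hx
      rw [le_abs]
      left
      linarith)
  have hcheb' : (fullEst ε h (2 ^ i)).mean G ({x | ¬ x ≤ 2 * 4 ^ i}.indicator 1) ≤ 1 / 20000 := by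
    rw [le_div_iff₀ (by norm_num)]
    refine le_of_mul_le_mul_left ?_ (show (0 : ℝ) < (4 ^ i) ^ 2 by positivity)
    have : ε ^ 2 * 4 ^ i * m ≤ 1 * 4 ^ i * 4 ^ i := by gcongr
    nlinarith
  have hmark := mul_mean_trunc_none_le G (budget ε h i) (fullEst (n := n) ε h (2 ^ i))
  set pn := ((fullEst ε h (2 ^ i)).trunc (budget ε h i)).mean G
    (fun x => x.elim 1 fun _ => (0 : ℝ)) with hpn
  have hpn0 : 0 ≤ pn := mean_nonneg G _ (by rintro (_ | x) <;> simp)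
  have hpn' : pn ≤ 1 / 128 := by
    have hE : (0 : ℝ) < 2 ^ i / ε ^ 2 := by positivity
    have hb : 5120000 * (4 * (h : ℝ) + 5) * (2 ^ i / ε ^ 2) ≤ budget ε h i := by
      rw [← mul_div_assoc]
      exact Nat.le_ceil _
    have hc2 : (fullEst (n := n) ε h (2 ^ i)).cost G ≤
        40000 * (4 * (h : ℝ) + 5) * (2 ^ i / ε ^ 2) := by
      have h1 : (2 : ℝ) ^ i ≤ 2 ^ i / ε ^ 2 := by
        rw [le_div_iff₀ (by positivity)]
        have : (0 : ℝ) < 2 ^ i := by positivity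
        nlinarith
      have h2 : 20000 / ε ^ 2 ≤ 20000 * (2 ^ i / ε ^ 2) := by
        rw [mul_div_assoc']
        gcongr
        have : (1 : ℝ) ≤ 2 ^ i := one_le_pow₀ (by norm_num)
        linarith
      have h3 : m / 4 ^ i ≤ 1 := by rwa [div_le_one h4]
      have h5 : (0 : ℝ) ≤ m / 4 ^ i := by positivity
      push_cast at hc
      have hh : (0 : ℝ) ≤ h := Nat.cast_nonneg h
      calc _ ≤ 2 ^ i + (4 * (h : ℝ) + 5) * (m / 4 ^ i * (2 ^ i + 20000 / ε ^ 2)) := hc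
        _ ≤ 2 ^ i / ε ^ 2 + (4 * (h : ℝ) + 5) *
            (1 * (2 ^ i / ε ^ 2 + 20000 * (2 ^ i / ε ^ 2))) := by gcongr
        _ ≤ _ := by nlinarith [mul_nonneg hE.le hh]
    set X := (4 * (h : ℝ) + 5) * (2 ^ i / ε ^ 2) with hX
    have hX0 : 0 < X := by positivity
    have h6 : 5120000 * X * pn ≤ 40000 * X := by
      have : 5120000 * X ≤ (budget ε h i : ℝ) + 1 := by
        rw [hX]
        linarith
      calc 5120000 * X * pn ≤ (budget ε h i + 1) * pn := by gcongr
        _ ≤ _ := hmark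
        _ ≤ 40000 * X := by
          rw [hX]
          linarith
    nlinarith
  have htr := mean_trunc_le G (budget ε h i) (fullEst (n := n) ε h (2 ^ i))
    (indicator_one_nonneg {x | ¬ x ≤ 2 * 4 ^ i})
  have hsum : belowReject G (belowEst ε h i) (2 * 4 ^ i) ≤ pn +
      ((fullEst ε h (2 ^ i)).trunc (budget ε h i)).mean G
        (fun o => o.elim 0 ({x | ¬ x ≤ 2 * 4 ^ i}.indicator 1)) := by
    rw [hpn, ← mean_add]
    refine mean_mono G _ ?_
    rintro (_ | x)
    · simp
    · by_cases hx : x ≤ 2 * 4 ^ i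
      · simp [hx]
      · have h1 : x ∈ {x : ℝ | ¬ x ≤ 2 * 4 ^ i} := hx
        simp only [Option.elim_some, Set.indicator_of_mem h1, Pi.one_apply, zero_add]
        split_ifs <;> norm_num
  linarith

variable [NeZero n]

theorem mean_sq_aboveEst_le (hn : n ≤ 2 ^ h) (hε : 0 < ε) (hε1 : ε ≤ 1) {m : ℝ}
    (hm : edgeSum (adjWeight G) Finset.univ = m) :
    (aboveEst ε h i).mean G (fun x => (x - m) ^ 2) ≤
      ε ^ 2 / 1000 * (m * (m + (topGuess n i : ℝ) ^ 2)) := by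
  have := mean_sq_highEst_le G hn hε hε1 (b := 2 ^ i) (β := topGuess n i) (by positivity)
    (le_topGuess_mul i)
  rwa [hm] at this

/-- Let `y` be the squared guess. If `y ≤ 4m`, the variance is of order `ε²m²` and Chebyshev applies
at distance `εm`. If `y > 4m`, an accepted output is at least `y/2`, hence at distance at least
`y/4` from `m`, while the variance is of order `my`. -/
theorem mean_aboveEst_le (hn : n ≤ 2 ^ h) (hε : 0 < ε) (hε1 : ε ≤ 1) {m : ℝ}
    (hm : edgeSum (adjWeight G) Finset.univ = m) (hm1 : 1 ≤ m) :
    (aboveEst ε h i).mean G (((Set.Icc ((1 - ε) * m) ((1 + ε) * m))ᶜ ∩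
        {y | (topGuess n i : ℝ) ^ 2 / 2 ≤ y}).indicator 1) ≤ 8 / 1000 ∧
      (m ≤ (topGuess n i : ℝ) ^ 2 →
        (aboveEst ε h i).mean G (((Set.Icc ((1 - ε) * m) ((1 + ε) * m))ᶜ ∩
          {y | (topGuess n i : ℝ) ^ 2 / 2 ≤ y}).indicator 1) ≤
            32 / 1000 * (m / (topGuess n i : ℝ) ^ 2)) := by
  have hv := mean_sq_aboveEst_le G i hn hε hε1 hm
  set y := (topGuess n i : ℝ) ^ 2 with hy
  have hy0 : 0 < y := by
    have : (0 : ℝ) < topGuess n i := by exact_mod_cast NeZero.pos (topGuess n i)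
    positivity
  have hε2 : ε ^ 2 ≤ 1 := pow_le_one₀ hε.le hε1
  set P := (aboveEst ε h i).mean G
    (((Set.Icc ((1 - ε) * m) ((1 + ε) * m))ᶜ ∩ {x | y / 2 ≤ x}).indicator 1)
  by_cases hcase : y ≤ 4 * m
  · have h1 : (ε * m) ^ 2 * P ≤ _ := mul_mean_indicator_le G _ (by positivity) hv (by
      rintro x ⟨hx, -⟩
      by_contra hcon
      push Not at hcon
      rw [abs_lt] at hcon
      exact hx ⟨by linarith, by linarith⟩)
    have h2 : P ≤ 5 / 1000 := by
      refine le_of_mul_le_mul_left ?_ (show 0 < (ε * m) ^ 2 by positivity)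
      have : ε ^ 2 / 1000 * (m * (m + y)) ≤ ε ^ 2 / 1000 * (m * (m + 4 * m)) := by gcongr
      nlinarith
    refine ⟨by linarith, fun hmy => ?_⟩
    have : 1 / 4 ≤ m / y := by
      rw [div_le_div_iff₀ (by norm_num) hy0]
      linarith
    linarith
  · push Not at hcase
    have h1 : (y / 4) ^ 2 * P ≤ _ := mul_mean_indicator_le G _ (by positivity) hv (by
      rintro x ⟨-, hx⟩
      simp only [Set.mem_ofPred_eq] at hx
      rw [le_abs]
      left
      linarith)
    have h2 : P ≤ 32 / 1000 * (m / y) := by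
      refine le_of_mul_le_mul_left ?_ (show 0 < (y / 4) ^ 2 by positivity)
      have h3 : ε ^ 2 / 1000 * (m * (m + y)) ≤ 1 / 1000 * (m * (y + y)) := by
        gcongr
        linarith
      have h4 : (y / 4) ^ 2 * (32 / 1000 * (m / y)) = 1 / 1000 * (m * (y + y)) := by
        field_simp
        ring
      linarith
    refine ⟨h2.trans ?_, fun _ => h2⟩
    have : m / y ≤ 1 / 4 := by
      rw [div_le_div_iff₀ hy0 (by norm_num)]
      linarith
    linarith

/-- A rejected output is below `m/2`, while the variance is at most `m²/500`. -/
theorem aboveReject_aboveEst_le (hn : n ≤ 2 ^ h) (hε : 0 < ε) (hε1 : ε ≤ 1) {m : ℝ}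
    (hm : edgeSum (adjWeight G) Finset.univ = m) (hm1 : 1 ≤ m)
    (hmi : (topGuess n i : ℝ) ^ 2 ≤ m) :
    aboveReject G (aboveEst ε h i) ((topGuess n i : ℝ) ^ 2 / 2) ≤ 1 / 64 := by
  have hv := mean_sq_aboveEst_le G i hn hε hε1 hm
  set y := (topGuess n i : ℝ) ^ 2 with hy
  have hε2 : ε ^ 2 ≤ 1 := pow_le_one₀ hε.le hε1
  have h1 : (m / 2) ^ 2 * aboveReject G (aboveEst ε h i) (y / 2) ≤ _ :=
    mul_mean_indicator_le G _ (by positivity) hv (by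
      intro x hx
      simp only [Set.mem_ofPred_eq, not_le] at hx
      rw [le_abs]
      right
      linarith)
  refine le_of_mul_le_mul_left ?_ (show 0 < (m / 2) ^ 2 by positivity)
  have h3 : ε ^ 2 / 1000 * (m * (m + y)) ≤ 1 / 1000 * (m * (m + m)) := by
    have : 0 ≤ y := by positivity
    gcongr
  nlinarith

/-- The expected number of queries at level `i`. -/
theorem cost_belowEst_add_cost_aboveEst_le (hn : n ≤ 2 ^ h) (hε : 0 < ε) (hε1 : ε ≤ 1) {m : ℝ}
    (hm : edgeSum (adjWeight G) Finset.univ = m) (hm0 : 0 ≤ m) :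
    (belowEst (n := n) ε h i).cost G + (aboveEst ε h i).cost G ≤
      6000000 * (4 * h + 5) / ε ^ 2 * 2 ^ i * (1 + m / (topGuess n i : ℝ) ^ 2) := by
  have h1 := cost_trunc_le G (budget ε h i) (fullEst (n := n) ε h (2 ^ i))
  have h2 := cost_highEst_le G hn hε hε1 (b := 2 ^ i) (β := topGuess n i) (by positivity)
    (topGuess_sub_one_mul_le i)
  rw [hm] at h2
  have hh : (0 : ℝ) ≤ h := Nat.cast_nonneg h
  have hb := (Nat.ceil_lt_add_one
    (show 0 ≤ 5120000 * (4 * (h : ℝ) + 5) * 2 ^ i / ε ^ 2 by positivity)).le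
  have hE : (1 : ℝ) ≤ 2 ^ i / ε ^ 2 := by
    rw [le_div_iff₀ (by positivity)]
    have h3 : (1 : ℝ) ≤ 2 ^ i := one_le_pow₀ (by norm_num)
    have h4 : ε ^ 2 ≤ 1 := pow_le_one₀ hε.le hε1
    linarith
  have hX : 1 ≤ (4 * (h : ℝ) + 5) * (2 ^ i / ε ^ 2) := by nlinarith
  set x := m / (topGuess n i : ℝ) ^ 2
  have hx : 0 ≤ x := by positivity
  have e1 : 5120000 * (4 * (h : ℝ) + 5) * 2 ^ i / ε ^ 2 =
      5120000 * ((4 * (h : ℝ) + 5) * (2 ^ i / ε ^ 2)) := by ring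
  have e2 : 80000 * (4 * (h : ℝ) + 5) * ((2 ^ i : ℕ) : ℝ) / ε ^ 2 * (1 + x) =
      80000 * ((4 * (h : ℝ) + 5) * (2 ^ i / ε ^ 2)) * (1 + x) := by
    push_cast
    ring
  have e3 : 6000000 * (4 * (h : ℝ) + 5) / ε ^ 2 * 2 ^ i * (1 + x) =
      6000000 * ((4 * (h : ℝ) + 5) * (2 ^ i / ε ^ 2)) * (1 + x) := by ring
  rw [e1] at hb
  rw [e2] at h2
  rw [e3]
  have h3 : (belowEst (n := n) ε h i).cost G ≤
      5120000 * ((4 * (h : ℝ) + 5) * (2 ^ i / ε ^ 2)) + 1 := h1.trans (by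
        unfold budget
        rw [e1]
        exact hb)
  have h4 : (aboveEst (n := n) ε h i).cost G ≤ _ := h2
  nlinarith [mul_nonneg (zero_le_one.trans hX) hx]

end Level

section Search

variable [NeZero n] {ε : ℝ} {h l : ℕ} {m : ℝ}

/-- The fraction is the geometric sum of `4^(j - l)` over `i ≤ j ≤ l`. The factor `13/100` covers
the errors `2/10000` from below and `4 · 32/1000` from above, and `1/64` bounds the probability of
passing level `l`. -/
theorem mean_search_le (hn : n ≤ 2 ^ h) (hε : 0 < ε) (hε1 : ε ≤ 1)
    (hm : edgeSum (adjWeight G) Finset.univ = m) (hm1 : 1 ≤ m) (hl : (4 : ℝ) ^ l ≤ 4 * m)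
    (hlt : ∀ j < l, m * 4 ^ l ≤ 4 * 4 ^ j * (topGuess n j : ℝ) ^ 2 ∧ m ≤ (topGuess n j : ℝ) ^ 2)
    (hge : ∀ i, l ≤ i → m ≤ 4 ^ i ∨ (topGuess n i : ℝ) ^ 2 ≤ m) (k i : ℕ) (hi : i ≤ l)
    (hk : l + 1 ≤ k + i) :
    (search ε h k i).mean G ((Set.Icc ((1 - ε) * m) ((1 + ε) * m))ᶜ.indicator 1) ≤
      13 / 100 * ((4 * 4 ^ l - 4 ^ i) / (3 * 4 ^ l)) + 1 / 64 := by
  induction k generalizing i with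
  | zero => omega
  | succ k ih =>
    have h4l : (0 : ℝ) < 4 ^ l := by positivity
    have h4i : (0 : ℝ) < 4 ^ i := by positivity
    have hF := mean_firstOf_le G (belowEst ε h i) (2 * 4 ^ i) (aboveEst ε h i)
      ((topGuess n i : ℝ) ^ 2 / 2) (search ε h k (i + 1)) (Set.Icc ((1 - ε) * m) ((1 + ε) * m))ᶜ
    have hlow := mean_belowEst_le G i hn hε hm hm1
    obtain ⟨hhigh1, hhigh2⟩ := mean_aboveEst_le G i hn hε hε1 hm hm1
    have hlow' : 4 ^ i / (20000 * m) ≤ 2 / 10000 * ((4 : ℝ) ^ i / 4 ^ l) := by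
      have e : 2 / 10000 * ((4 : ℝ) ^ i / 4 ^ l) = 4 ^ i / (5000 * 4 ^ l) := by
        field_simp
        norm_num
      rw [e]
      exact div_le_div_of_nonneg_left h4i.le (by positivity) (by linarith)
    rw [search]
    refine hF.trans ?_
    have hR0 := belowReject_nonneg G (belowEst (n := n) ε h i) (2 * 4 ^ i)
    have hR1 := belowReject_le_one G (belowEst (n := n) ε h i) (2 * 4 ^ i)
    have hA0 := aboveReject_nonneg G (aboveEst (n := n) ε h i) ((topGuess n i : ℝ) ^ 2 / 2)
    have hA1 := aboveReject_le_one G (aboveEst (n := n) ε h i) ((topGuess n i : ℝ) ^ 2 / 2)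
    have hS0 := mean_nonneg G (search ε h k (i + 1))
      (indicator_one_nonneg (Set.Icc ((1 - ε) * m) ((1 + ε) * m))ᶜ)
    have hS1 := mean_le_one G (search ε h k (i + 1))
      (indicator_one_le_one (Set.Icc ((1 - ε) * m) ((1 + ε) * m))ᶜ)
    rcases hi.lt_or_eq with hil | rfl
    · have hrec := ih (i + 1) hil (by omega)
      have hhigh := hhigh2 (hlt i hil).2
      have hy0 : (0 : ℝ) < (topGuess n i : ℝ) ^ 2 := by
        have := (hlt i hil).2
        linarith
      have hhigh' : m / (topGuess n i : ℝ) ^ 2 ≤ 4 * (4 ^ i / 4 ^ l) := by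
        rw [mul_div_assoc', div_le_div_iff₀ hy0 h4l]
        exact (hlt i hil).1
      have hprod : belowReject G (belowEst ε h i) (2 * 4 ^ i) *
          aboveReject G (aboveEst ε h i) ((topGuess n i : ℝ) ^ 2 / 2) *
          (search ε h k (i + 1)).mean G
            ((Set.Icc ((1 - ε) * m) ((1 + ε) * m))ᶜ.indicator 1) ≤
          (search ε h k (i + 1)).mean G
            ((Set.Icc ((1 - ε) * m) ((1 + ε) * m))ᶜ.indicator 1) :=
        mul_le_of_le_one_left hS0 (mul_le_one₀ hR1 hA0 hA1)
      have e : (4 * (4 : ℝ) ^ l - 4 ^ i) / (3 * 4 ^ l) =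
          4 ^ i / 4 ^ l + (4 * 4 ^ l - 4 ^ (i + 1)) / (3 * 4 ^ l) := by
        field_simp
        ring
      rw [e]
      have hpos : (0 : ℝ) < 4 ^ i / 4 ^ l := by positivity
      linarith
    -- At level `l` one of the two guesses has crossed `m`, so the corresponding estimator is rarely
    -- rejected. Everything after that level is counted as failure.
    · have hrej : belowReject G (belowEst ε h i) (2 * 4 ^ i) *
          aboveReject G (aboveEst ε h i) ((topGuess n i : ℝ) ^ 2 / 2) ≤ 1 / 64 := by
        rcases hge i le_rfl with hc | hc
        · have := belowReject_belowEst_le G i hn hε hε1 hm hm1 hc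
          nlinarith
        · have := aboveReject_aboveEst_le G i hn hε hε1 hm hm1 hc
          nlinarith
      have hprod : belowReject G (belowEst ε h i) (2 * 4 ^ i) *
          aboveReject G (aboveEst ε h i) ((topGuess n i : ℝ) ^ 2 / 2) *
          (search ε h k (i + 1)).mean G
            ((Set.Icc ((1 - ε) * m) ((1 + ε) * m))ᶜ.indicator 1) ≤ 1 / 64 :=
        (mul_le_of_le_one_right (mul_nonneg hR0 hA0) hS1).trans hrej
      have e : (4 * (4 : ℝ) ^ i - 4 ^ i) / (3 * 4 ^ i) = 1 := by
        field_simp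
        norm_num
      rw [e]
      rw [div_self h4i.ne'] at hlow'
      linarith

/-- Per level the cost bound grows by `2` from `2 ^ i` and by `16` from the shrinking squared guess,
whereas continuing has probability at most `1/64`. The constant `34` satisfies `17 + 34 · 32/64 =
34`. -/
theorem cost_search_le_of_le (hn : n ≤ 2 ^ h) (hε : 0 < ε) (hε1 : ε ≤ 1)
    (hm : edgeSum (adjWeight G) Finset.univ = m) (hm1 : 1 ≤ m)
    (hge : ∀ i, l ≤ i → m ≤ 4 ^ i ∨ (topGuess n i : ℝ) ^ 2 ≤ m)
    (htop : ∀ j, m ≤ 16 ^ (j + 1) * (topGuess n (l + j) : ℝ) ^ 2) (k j : ℕ) :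
    (search (n := n) ε h k (l + j)).cost G ≤
      34 * (6000000 * (4 * h + 5) / ε ^ 2) * 2 ^ l * 32 ^ j := by
  set A : ℝ := 6000000 * (4 * h + 5) / ε ^ 2 with hA
  have hA0 : 0 < A := by positivity
  induction k generalizing j with
  | zero =>
    simp only [search, cost]
    positivity
  | succ k ih =>
    have hF := cost_firstOf_le G (belowEst ε h (l + j)) (2 * 4 ^ (l + j)) (aboveEst ε h (l + j))
      ((topGuess n (l + j) : ℝ) ^ 2 / 2) (search ε h k (l + j + 1))
    have hlev := cost_belowEst_add_cost_aboveEst_le G (l + j) hn hε hε1 hm (by linarith)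
    rw [← hA] at hlev
    have hy0 : (0 : ℝ) < (topGuess n (l + j) : ℝ) ^ 2 := by
      have : (0 : ℝ) < topGuess n (l + j) := by exact_mod_cast NeZero.pos (topGuess n (l + j))
      positivity
    have hx : 1 + m / (topGuess n (l + j) : ℝ) ^ 2 ≤ 17 * 16 ^ j := by
      have h1 : m / (topGuess n (l + j) : ℝ) ^ 2 ≤ 16 ^ (j + 1) := by
        rw [div_le_iff₀ hy0]
        exact htop j
      have h2 : (1 : ℝ) ≤ 16 ^ j := one_le_pow₀ (by norm_num)
      rw [pow_succ (16 : ℝ)] at h1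
      linarith
    have hlev' : A * 2 ^ (l + j) * (1 + m / (topGuess n (l + j) : ℝ) ^ 2) ≤
        17 * A * 2 ^ l * 32 ^ j := by
      calc _ ≤ A * 2 ^ (l + j) * (17 * 16 ^ j) := by gcongr
        _ = 17 * A * 2 ^ l * (2 * 16) ^ j := by
          rw [pow_add, mul_pow]
          ring
        _ = _ := by norm_num
    have hR0 := belowReject_nonneg G (belowEst (n := n) ε h (l + j)) (2 * 4 ^ (l + j))
    have hR1 := belowReject_le_one G (belowEst (n := n) ε h (l + j)) (2 * 4 ^ (l + j))
    have hB0 := aboveReject_nonneg G (aboveEst (n := n) ε h (l + j))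
      ((topGuess n (l + j) : ℝ) ^ 2 / 2)
    have hB1 := aboveReject_le_one G (aboveEst (n := n) ε h (l + j))
      ((topGuess n (l + j) : ℝ) ^ 2 / 2)
    have hrej : belowReject G (belowEst ε h (l + j)) (2 * 4 ^ (l + j)) *
        aboveReject G (aboveEst ε h (l + j)) ((topGuess n (l + j) : ℝ) ^ 2 / 2) ≤ 1 / 64 := by
      rcases hge (l + j) (Nat.le_add_right _ _) with hc | hc
      · have := belowReject_belowEst_le G (l + j) hn hε hε1 hm hm1 hc
        nlinarith
      · have := aboveReject_aboveEst_le G (l + j) hn hε hε1 hm hm1 hc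
        nlinarith
    have hrec := ih (j + 1)
    have hprod := mul_le_mul hrej hrec (cost_nonneg G _) (by norm_num)
    rw [search]
    refine hF.trans ?_
    rw [← add_assoc] at hprod
    rw [pow_succ (32 : ℝ)] at hprod
    linarith

/-- Up to a common factor, a level `j < l` costs at most `2 · 2^j`, which sums to `2 (2^l - 2^i)`;
the levels from `l` on add `34 · 2^l`. -/
theorem cost_search_le (hn : n ≤ 2 ^ h) (hε : 0 < ε) (hε1 : ε ≤ 1)
    (hm : edgeSum (adjWeight G) Finset.univ = m) (hm1 : 1 ≤ m)
    (hlt : ∀ j < l, m ≤ (topGuess n j : ℝ) ^ 2)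
    (hge : ∀ i, l ≤ i → m ≤ 4 ^ i ∨ (topGuess n i : ℝ) ^ 2 ≤ m)
    (htop : ∀ j, m ≤ 16 ^ (j + 1) * (topGuess n (l + j) : ℝ) ^ 2) (k i : ℕ) (hi : i ≤ l) :
    (search (n := n) ε h k i).cost G ≤
      6000000 * (4 * h + 5) / ε ^ 2 * (36 * 2 ^ l - 2 * 2 ^ i) := by
  have hbase := cost_search_le_of_le G hn hε hε1 hm hm1 hge htop
  set A : ℝ := 6000000 * (4 * h + 5) / ε ^ 2 with hA
  have hA0 : 0 < A := by positivity
  induction k generalizing i with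
  | zero =>
    simp only [search, cost]
    have h1 : (2 : ℝ) ^ i ≤ 2 ^ l := pow_le_pow_right₀ (by norm_num) hi
    have h2 : (0 : ℝ) < 2 ^ l := by positivity
    refine mul_nonneg hA0.le ?_
    linarith
  | succ k ih =>
    rcases hi.lt_or_eq with hil | rfl
    · have hF := cost_firstOf_le G (belowEst ε h i) (2 * 4 ^ i) (aboveEst ε h i)
        ((topGuess n i : ℝ) ^ 2 / 2) (search ε h k (i + 1))
      have hlev := cost_belowEst_add_cost_aboveEst_le G i hn hε hε1 hm (by linarith)
      rw [← hA] at hlev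
      have hx : 1 + m / (topGuess n i : ℝ) ^ 2 ≤ 2 := by
        have : m / (topGuess n i : ℝ) ^ 2 ≤ 1 := div_le_one_of_le₀ (hlt i hil) (by positivity)
        linarith
      have hlev' : A * 2 ^ i * (1 + m / (topGuess n i : ℝ) ^ 2) ≤ A * 2 ^ i * 2 := by gcongr
      have hprod := mul_le_of_le_one_left (cost_nonneg G (search ε h k (i + 1)))
        (mul_le_one₀ (belowReject_le_one G (belowEst (n := n) ε h i) (2 * 4 ^ i))
          (aboveReject_nonneg G (aboveEst (n := n) ε h i) ((topGuess n i : ℝ) ^ 2 / 2))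
          (aboveReject_le_one G (aboveEst (n := n) ε h i) ((topGuess n i : ℝ) ^ 2 / 2)))
      have hrec := ih (i + 1) hil
      rw [search]
      refine hF.trans ?_
      rw [pow_succ] at hrec
      nlinarith
    · have := hbase (k + 1) 0
      rw [add_zero, pow_zero, mul_one] at this
      refine this.trans (le_of_eq ?_)
      ring

end Search

end QueryProg

/-! ### The final algorithm and its constants -/

namespace QueryProg

theorem edgeSum_adjWeight_univ_le {n : ℕ} (G : SimpleGraph (Fin n)) :
    edgeSum (adjWeight G) Finset.univ ≤ (n : ℝ) ^ 2 := by
  have h1 : ∑ u : Fin n, ∑ v : Fin n, adjWeight G u v ≤ ∑ _u : Fin n, ∑ _v : Fin n, (1 : ℝ) :=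
    Finset.sum_le_sum fun u _ => Finset.sum_le_sum fun v _ => by
      unfold adjWeight
      split_ifs <;> norm_num
  simp only [Finset.sum_const, Finset.card_univ, Fintype.card_fin, nsmul_eq_mul, mul_one] at h1
  rw [edgeSum]
  nlinarith [sq_nonneg (n : ℝ)]

theorem isIndepSet_univ_iff {n : ℕ} (G : SimpleGraph (Fin n)) :
    G.IsIndepSet ((Finset.univ : Finset (Fin n)) : Set (Fin n)) ↔ G.edgeSet.ncard = 0 := by
  rw [Set.ncard_eq_zero (Set.toFinite _), SimpleGraph.edgeSet_eq_empty]
  constructor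
  · intro h
    ext u v
    simp only [SimpleGraph.bot_adj, iff_false]
    exact fun huv => h (by simp) (by simp) huv.ne huv
  · rintro rfl u - v - -
    exact id

/-- The algorithm that estimates the number of edges. -/
noncomputable def edgeEst : (n : ℕ) → ℝ → QueryProg n ℝ
  | 0, _ => ret 0
  | n + 1, ε => ifIndep Finset.univ (ret 0) (search ε (Nat.clog 2 (n + 1)) (n + 2) 0)

theorem clog_bound {n : ℕ} (hn : 2 ≤ n) :
    4 * (Nat.clog 2 n : ℝ) + 5 ≤ 20 * Real.log n := by
  have hlog2 := Real.log_two_gt_d9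
  have hn2 : Real.log 2 ≤ Real.log n :=
    Real.log_le_log (by norm_num) (by exact_mod_cast hn)
  have h1 : 2 ^ (Nat.clog 2 n - 1) < n := Nat.pow_pred_clog_lt_self (by norm_num) (by omega)
  have hpos : 0 < Nat.clog 2 n := Nat.clog_pos (by norm_num) hn
  have h2 : ((Nat.clog 2 n - 1 : ℕ) : ℝ) * Real.log 2 ≤ Real.log n := by
    rw [← Real.log_pow]
    refine Real.log_le_log (by positivity) ?_
    exact_mod_cast h1.le
  rw [Nat.cast_sub hpos, Nat.cast_one] at h2
  have h3 : (Nat.clog 2 n : ℝ) ≤ 3 * Real.log n := by nlinarith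
  linarith

theorem mean_edgeEst_ge {n : ℕ} (G : SimpleGraph (Fin n)) {ε : ℝ} (hn : 1 ≤ n) (hε : 0 < ε)
    (hε1 : ε ≤ 1) :
    2 / 3 ≤ (edgeEst n ε).mean G ((Set.Icc ((1 - ε) * (G.edgeSet.ncard : ℝ))
      ((1 + ε) * (G.edgeSet.ncard : ℝ))).indicator 1) := by
  obtain ⟨n, rfl⟩ : ∃ k, n = k + 1 := ⟨n - 1, by omega⟩
  rw [edgeEst, mean_ifIndep]
  by_cases h0 : G.edgeSet.ncard = 0
  · rw [if_pos ((isIndepSet_univ_iff G).mpr h0), h0]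
    simp [mean]
    norm_num
  · rw [if_neg fun h => h0 ((isIndepSet_univ_iff G).mp h)]
    have hm := edgeSum_adjWeight_univ G
    have hmn := edgeSum_adjWeight_univ_le G
    set m : ℝ := (G.edgeSet.ncard : ℝ) with hmdef
    have hm1 : 1 ≤ m := by
      rw [hmdef]
      exact_mod_cast Nat.one_le_iff_ne_zero.mpr h0
    rw [hm] at hmn
    obtain ⟨l, hln, hl4, -, hlt, hge, -⟩ := exists_level hn hm1 hmn
    -- Since `l` is at most the number of vertices, `n + 2` levels suffice to reach it, and the
    -- default output `0` of an exhausted search plays no role.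
    have hbad := mean_search_le G (Nat.le_pow_clog (by norm_num) (n + 1)) hε hε1 hm hm1 hl4 hlt hge
      (n + 2) 0 (Nat.zero_le _) (by omega)
    have hsum := mean_add G (search ε (Nat.clog 2 (n + 1)) (n + 2) 0)
      ((Set.Icc ((1 - ε) * m) ((1 + ε) * m)).indicator 1)
      ((Set.Icc ((1 - ε) * m) ((1 + ε) * m))ᶜ.indicator 1)
    have hone : (fun x => (Set.Icc ((1 - ε) * m) ((1 + ε) * m)).indicator (1 : ℝ → ℝ) x +
        (Set.Icc ((1 - ε) * m) ((1 + ε) * m))ᶜ.indicator 1 x) = fun _ => 1 := by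
      funext x
      exact congrFun (Set.indicator_self_add_compl (Set.Icc ((1 - ε) * m) ((1 + ε) * m)) 1) x
    rw [hone, mean_const] at hsum
    have hfrac : (4 * (4 : ℝ) ^ l - 4 ^ 0) / (3 * 4 ^ l) ≤ 4 / 3 := by
      have : (0 : ℝ) < 4 ^ l := by positivity
      rw [div_le_div_iff₀ (by positivity) (by norm_num)]
      linarith
    linarith

theorem cost_edgeEst_le {n : ℕ} (G : SimpleGraph (Fin n)) {ε : ℝ} (hε : 0 < ε)
    (hε1 : ε ≤ 1) (hm0 : 1 ≤ G.edgeSet.ncard) :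
    (edgeEst n ε).cost G ≤ 20000000000 * (Real.log n / ε ^ (5 / 2 : ℝ)) *
      min (√(G.edgeSet.ncard : ℝ)) (√((n : ℝ) / √(G.edgeSet.ncard : ℝ))) := by
  have hm := edgeSum_adjWeight_univ G
  have hmn := edgeSum_adjWeight_univ_le G
  have hn2 : 2 ≤ n := by
    by_contra hcon
    have h1 : Subsingleton (Fin n) := by
      rw [Fin.subsingleton_iff_le_one]
      omega
    have h2 := (isIndepSet_univ_iff G).mp fun u _ v _ huv => absurd (Subsingleton.elim u v) huv
    omega
  have hclog := clog_bound hn2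
  obtain ⟨n, rfl⟩ : ∃ k, n = k + 1 := ⟨n - 1, by omega⟩
  rw [edgeEst, cost_ifIndep, if_neg fun h => by
    have := (isIndepSet_univ_iff G).mp h
    omega]
  set m : ℝ := (G.edgeSet.ncard : ℝ) with hmdef
  have hm1 : 1 ≤ m := by
    rw [hmdef]
    exact_mod_cast hm0
  rw [hm] at hmn
  obtain ⟨l, -, hl4, hl8, hlt, hge, htop⟩ := exists_level (by omega) hm1 hmn
  have hcost := cost_search_le G (Nat.le_pow_clog (by norm_num) (n + 1)) hε hε1 hm hm1
    (fun j hj => (hlt j hj).2) hge htop (n + 2) 0 (Nat.zero_le _)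
  set K : ℝ := 4 * (Nat.clog 2 (n + 1) : ℝ) + 5 with hK
  set N : ℝ := ((n + 1 : ℕ) : ℝ) with hN
  have hN2 : 2 ≤ N := by
    rw [hN]
    exact_mod_cast hn2
  have hsm : 1 ≤ √m := Real.one_le_sqrt.mpr hm1
  have hsmN : √m ≤ N := by
    rw [Real.sqrt_le_left (by linarith)]
    exact hmn
  have h4l : ((2 : ℝ) ^ l) ^ 2 = 4 ^ l := by
    rw [← pow_mul, mul_comm, pow_mul]
    norm_num
  -- After squaring, the constants `4` and `8` from `exists_level` are both below `9`.
  have hmin : (2 : ℝ) ^ l ≤ 3 * min (√m) (√(N / √m)) := by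
    rw [mul_min_of_nonneg _ _ (by norm_num), le_min_iff]
    constructor
    · refine le_of_sq_le_sq ?_ (by positivity)
      rw [h4l, mul_pow, Real.sq_sqrt (by linarith)]
      linarith
    · refine le_of_sq_le_sq ?_ (by positivity)
      rw [h4l, mul_pow, Real.sq_sqrt (by positivity), mul_div_assoc', le_div_iff₀ (by linarith)]
      linarith
  have hmin1 : 1 ≤ min (√m) (√(N / √m)) :=
    le_min hsm (Real.one_le_sqrt.mpr ((one_le_div (by linarith)).mpr hsmN))
  set φ := min (√m) (√(N / √m))
  have hK1 : 5 ≤ K := by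
    have : (0 : ℝ) ≤ Nat.clog 2 (n + 1) := Nat.cast_nonneg _
    linarith
  -- The search costs only `ε⁻²`; since `ε ≤ 1`, the exponent `5/2` is a weaker requirement.
  have hεpow : 1 / ε ^ 2 ≤ 1 / ε ^ (5 / 2 : ℝ) := by
    have h1 : 0 < ε ^ (5 / 2 : ℝ) := Real.rpow_pos_of_pos hε _
    refine one_div_le_one_div_of_le h1 ?_
    rw [← Real.rpow_natCast ε 2]
    exact Real.rpow_le_rpow_of_exponent_ge hε hε1 (by norm_num)
  have hε2 : 1 ≤ 1 / ε ^ 2 := by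
    rw [le_div_iff₀ (by positivity), one_mul]
    exact pow_le_one₀ hε.le hε1
  set E := 1 / ε ^ 2 with hE
  have e1 : 6000000 * K / ε ^ 2 * (36 * 2 ^ l - 2 * 2 ^ 0) = 6000000 * (K * E) * (36 * 2 ^ l - 2) := by
    rw [hE]
    ring
  rw [e1] at hcost
  have hKE : 5 ≤ K * E := by nlinarith
  -- The initial independence query is absorbed by the term `-2`.
  have h5 : 1 + 6000000 * (K * E) * (36 * 2 ^ l - 2) ≤ 6000000 * (K * E) * (36 * (3 * φ)) := by
    have : K * E * 2 ^ l ≤ K * E * (3 * φ) := by gcongr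
    nlinarith
  have h6 : K * E ≤ 20 * Real.log N * (1 / ε ^ (5 / 2 : ℝ)) := by
    have hlog : 0 ≤ Real.log N := Real.log_nonneg (by linarith)
    gcongr
  calc _ ≤ 1 + 6000000 * (K * E) * (36 * 2 ^ l - 2) := by linarith
    _ ≤ 6000000 * (K * E) * (36 * (3 * φ)) := h5
    _ ≤ 6000000 * (20 * Real.log N * (1 / ε ^ (5 / 2 : ℝ))) * (36 * (3 * φ)) := by gcongr
    _ = 12960000000 * (Real.log N / ε ^ (5 / 2 : ℝ) * φ) := by ring
    _ ≤ 20000000000 * (Real.log N / ε ^ (5 / 2 : ℝ) * φ) := by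
      have : 0 ≤ Real.log N / ε ^ (5 / 2 : ℝ) * φ :=
        mul_nonneg (div_nonneg (Real.log_nonneg (by linarith)) (Real.rpow_nonneg hε.le _))
          (by linarith)
      linarith
    _ = _ := by ring

theorem cost_edgeEst_le_one {n : ℕ} (G : SimpleGraph (Fin n)) (ε : ℝ)
    (hm : G.edgeSet.ncard = 0) : (edgeEst n ε).cost G ≤ 1 := by
  cases n with
  | zero => simp [edgeEst, cost]
  | succ n =>
    rw [edgeEst, cost_ifIndep, if_pos ((isIndepSet_univ_iff G).mpr hm)]
    simp [cost]

end QueryProg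

theorem mainTheorem1 :
    ∃ (C : ℝ) (A : (n : ℕ) → (ε : ℝ) → GraphAlgorithm n),
      0 < C ∧
      ∀ (n : ℕ) (ε : ℝ), 1 ≤ n → 0 < ε → ε ≤ 1 →
        ∀ (G : SimpleGraph (Fin n)) (m : ℕ), m = G.edgeSet.ncard →
          -- the algorithm halts almost surely
          (A n ε).outputProb G Set.univ = 1 ∧
          -- the output is a `(1 ± ε)`-approximation of `m` with probability at least `2/3`
          2 / 3 ≤ (A n ε).outputProb G (Set.Icc ((1 - ε) * (m : ℝ)) ((1 + ε) * (m : ℝ))) ∧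
          -- the expected number of queries
          (1 ≤ m →
            (A n ε).expectedQueries G ≤
              ENNReal.ofReal (C * (Real.log (n : ℝ) / ε ^ (5 / 2 : ℝ)) *
                min (Real.sqrt (m : ℝ)) (Real.sqrt ((n : ℝ) / Real.sqrt (m : ℝ))))) ∧
          (m = 0 → (A n ε).expectedQueries G ≤ 1) := by
  refine ⟨20000000000, fun n ε => (QueryProg.edgeEst n ε).toAlgorithm, by norm_num, ?_⟩
  rintro n ε hn hε hε1 G m rfl
  refine ⟨QueryProg.outputProb_univ G _, ?_, fun hm => ?_, fun hm => ?_⟩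
  · refine le_trans ?_ (QueryProg.ofReal_mean_le_outputProb G _ _)
    refine le_trans (le_of_eq ?_)
      (ENNReal.ofReal_le_ofReal (QueryProg.mean_edgeEst_ge G hn hε hε1))
    rw [ENNReal.ofReal_div_of_pos (by norm_num)]
    norm_num
  · exact (QueryProg.expectedQueries_le G _).trans
      (ENNReal.ofReal_le_ofReal (QueryProg.cost_edgeEst_le G hε hε1 hm))
  · refine (QueryProg.expectedQueries_le G _).trans ?_
    rw [← ENNReal.ofReal_one]
    exact ENNReal.ofReal_le_ofReal (QueryProg.cost_edgeEst_le_one G ε hm)
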